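/- **Conventions.** A partition is a non-increasing finite sequence of non-negative integers, up to trailing zeros; its length $l(\lambda)$ is the number of its positive parts, and $\lambda'$ is its conjugate. $\langle k^l\rangle$ is the sequence $(k,\dots,k)$ of length $l$. For a partition $\nu$ and $r\ge 0$ put $\nu_{[r]}=(\nu_1,\dots,\nu_r)$ and $\nu_{(r+1,\dots)}=(\nu_{r+1},\nu_{r+2},\dots)$. The union $\cup$ of two sequences is obtained by appending the second to the first; a partition that is at most $r$ parts long is written with exactly $r$ parts where $r$ is clear. * For finite sequences put $\Delta(\mathcal X)=\prod_{i<j}(x_i-x_j)$ and $\Delta(\mathcal X;\mathcal Y)=\prod_{x\in\mathcal X,\,y\in\mathcal Y}(x-y)$. For $\mathcal X$ with $n$ elements, $\mathfrak s_\lambda(\mathcal X)=\det\bigl(x_i^{\lambda_j+n-j}\bigr)_{1\le i,j\le n}/\Delta(\mathcal X)$ if $l(\lambda)\le n$ (a quotient of polynomials, hence a polynomial) and $\mathfrak s_\lambda(\mathcal X)=0$ otherwise. The Littlewood-Schur function is $$LS_\lambda(\mathcal X;\mathcal Y)=\sum_{\mu,\nu}c^\lambda_{\mu\nu}\,\mathfrak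 s_\mu(\mathcal X)\,\mathfrak s_{\nu'}(\mathcal Y),$$ where $c^\lambda_{\mu\nu}$ are the Littlewood-Richardson coefficients, i.e. $\mathfrak s_\mu\mathfrak s_\nu=\sum_\lambda c^\lambda_{\mu\nu}\mathfrak s_\lambda$ in any number of variables. * The $(m,n)$-index of $\lambda$ is the largest (possibly negative) integer $k\le\min\{m,n\}$ such that $(m+1-k,n+1-k)\notin\lambda$, where, for $i,j\ge1$, $(i,j)\in\lambda$ means $i\le\lambda_j$. * Let $\rho_n=(n-1,\dots,1,0)$. For partitions $\mu,\nu$ of length at most $m$ and $n$, respectively, the $(m,n)$-overlap $\mu\star_{m,n}\nu$ is the partition of length at most $m+n$ such that $\mu\star_{m,n}\nu+\rho_{m+n}$ equals $(\mu+\rho_m)\cup(\nu+\rho_n)$ up to reordering, if it exists, and then $\varepsilon_{m,n}(\mu,\nu)$ is the sign of the sorting permutation. Otherwise $\mu\star_{m,n}\nu=\infty$ and $\varepsilon_{m,n}(\mu,\nu)=1$. Here $\infty$ is a symbol with $\infty\cup\kappa=\infty$ for every partition $\kappa$ and $LS_\infty=0$. **Statement.** Let $\mu,\nu$ be partitions,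 and let $\mathcal X$ and $\mathcal Y$ be sequences of $n$ and $m$ elements of a field, respectively, such that the elements of $\mathcal X$ are pairwise distinct. Fix an integer $l$ with $l(\mu)\le l\le n$ and let $k$ be the $(m,n-l)$-index of $\nu$. Suppose that $l\le n-k$, that $\mu+\langle k^l\rangle$ is a partition (i.e. its entries are non-negative), and that the $(m,l)$-index of $\mu+\langle k^l\rangle$ is $0$. Then $$LS_{\left(\mu\star_{l,n-l-k}\nu_{[n-l-k]}\right)\cup\nu_{(n+1-l-k,\dots)}}(-\mathcal X;\mathcal Y)=\sum_{\mathcal S,\mathcal T}\frac{\varepsilon_{l,n-l-k}\left(\mu,\nu_{[n-l-k]}\right)\,LS_{\mu+\langle k^l\rangle}(-\mathcal S;\mathcal Y)\,LS_\nu(-\mathcal T;\mathcal Y)}{\Delta(\mathcal T;\mathcal S)},$$ where the sum is over all subsequences $\mathcal S$ of $\mathcal X$ with $l$ elements, and $\mathcal T=\mathcal X\setminus\mathcal S$ is the complementary subsequence, with $n-l$ elements. In particular, if the overlap is $\infty$, then the right-hand side is $0$. -/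

import Mathlib

/-!
Partitions are Mathlib's `YoungDiagram`s, that is, partitions up to trailing zeros: the `j`-th part
is `la.rowLen (j - 1)`, the length is `la.colLen 0` and the conjugate is `la.transpose`. A sequence
of `n` variables is a function on `Fin n`, so that positions are counted from `0`.
-/

namespace LittlewoodSchur

open MvPolynomial

/-- `Δ(x) = ∏_{i < j} (x_i - x_j)`. -/
def delta {R : Type*} [CommRing R] {n : ℕ} (x : Fin n → R) : R :=
  ∏ i, ∏ j ∈ Finset.Ioi i, (x i - x j)

/-- The determinant of the matrix `(x_i ^ a_j)`. -/
def alternant {R : Type*} [CommRing R] {n : ℕ} (x : Fin n → R) (a : Fin n → ℕ) : R :=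
  Matrix.det (Matrix.of fun i j => x i ^ a j)

theorem delta_dvd_alternant {R : Type*} [CommRing R] {n : ℕ} (x : Fin n → R) (a : Fin n → ℕ) :
    delta x ∣ alternant x a := by
  have h1 : delta x ∣ (Matrix.vandermonde x).det := by
    rw [Matrix.det_vandermonde]
    refine Finset.prod_dvd_prod_of_dvd _ _ fun i _ =>
      Finset.prod_dvd_prod_of_dvd _ _ fun j _ => ⟨-1, by ring⟩
  refine h1.trans ?_
  let P : Polynomial R := ∏ i, (Polynomial.X - Polynomial.C (x i))
  have hP : P.Monic := Polynomial.monic_prod_X_sub_C _ _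
  have hdeg : P.degree ≤ (n : ℕ) := by
    refine (Polynomial.degree_prod_le _ _).trans ?_
    refine (Finset.sum_le_sum fun i _ => Polynomial.degree_X_sub_C_le (x i)).trans ?_
    simp
  have key : (Matrix.of fun i j => x i ^ a j) = Matrix.vandermonde x *
      Matrix.of fun (r j : Fin n) => ((Polynomial.X ^ a j : Polynomial R) %ₘ P).coeff r := by
    ext i j
    have hroot : P.eval (x i) = 0 := by
      simp only [P, Polynomial.eval_prod]
      exact Finset.prod_eq_zero (Finset.mem_univ i) (by simp)
    have h2 := congrArg (Polynomial.eval (x i))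
      (Polynomial.modByMonic_add_div (Polynomial.X ^ a j : Polynomial R) P)
    rw [← Polynomial.sum_modByMonic_coeff hP hdeg] at h2
    simp only [Polynomial.eval_add, Polynomial.eval_mul, hroot, zero_mul, add_zero,
      Polynomial.eval_pow, Polynomial.eval_X, Polynomial.eval_finsetSum,
      Polynomial.eval_monomial] at h2
    rw [Matrix.mul_apply, Matrix.of_apply, ← h2]
    exact Finset.sum_congr rfl fun r _ => by simp [Matrix.vandermonde_apply, mul_comm]
  rw [alternant, key, Matrix.det_mul]
  exact dvd_mul_right _ _

/-- The sequence `la + ρ_n` of length `n`, where `ρ_n = (n - 1, …, 1, 0)`. -/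
def shifted (n : ℕ) (la : YoungDiagram) (j : Fin n) : ℕ := la.rowLen j + (n - 1 - j)

/-- The Schur polynomial in `n` variables: the quotient of `det (X_i ^ (la_j + n - j))` by `Δ(X)`
when `la` has length at most `n`, and `0` otherwise. -/
noncomputable def schurPoly (n : ℕ) (la : YoungDiagram) : MvPolynomial (Fin n) ℤ :=
  if la.colLen 0 ≤ n then
    Classical.choose (delta_dvd_alternant (X : Fin n → MvPolynomial (Fin n) ℤ) (shifted n la))
  else 0

theorem delta_mul_schurPoly {n : ℕ} {la : YoungDiagram} (h : la.colLen 0 ≤ n) :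
    delta X * schurPoly n la = alternant X (shifted n la) := by
  rw [schurPoly, if_pos h]
  exact (Classical.choose_spec (delta_dvd_alternant _ _)).symm

theorem delta_X_ne_zero (n : ℕ) : delta (X : Fin n → MvPolynomial (Fin n) ℤ) ≠ 0 := by
  refine Finset.prod_ne_zero_iff.2 fun i _ => Finset.prod_ne_zero_iff.2 fun j hj => ?_
  rw [sub_ne_zero]
  intro h
  exact (Finset.mem_Ioi.1 hj).ne (X_injective h)

theorem delta_eq_alternant {R : Type*} [CommRing R] {n : ℕ} (x : Fin n → R) :
    delta x = alternant x (fun j => n - 1 - j) := by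
  have h := Matrix.det_projVandermonde 1 x
  simp only [Pi.one_apply, one_mul] at h
  rw [delta, ← h, alternant]
  congr 1
  ext i j
  simp only [Matrix.projVandermonde_apply, Matrix.of_apply, Pi.one_apply, one_pow, one_mul,
    Fin.val_rev]
  congr 1
  omega

/-- Polynomials that are multiplied by the sign of any permutation of the variables. -/
def Alternating {n : ℕ} (g : MvPolynomial (Fin n) ℤ) : Prop :=
  ∀ s : Equiv.Perm (Fin n), rename s g = (Equiv.Perm.sign s : ℤ) • g

theorem alternating_alternant {n : ℕ} (a : Fin n → ℕ) :
    Alternating (alternant (X : Fin n → MvPolynomial (Fin n) ℤ) a) := by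
  intro s
  have h := Matrix.det_permute s (Matrix.of fun i j => (X i : MvPolynomial (Fin n) ℤ) ^ a j)
  rw [alternant, AlgHom.map_det, zsmul_eq_mul]
  rw [← h]
  congr 1
  ext i j : 2
  simp

theorem alternating_delta (n : ℕ) :
    Alternating (delta (X : Fin n → MvPolynomial (Fin n) ℤ)) := by
  rw [delta_eq_alternant]; exact alternating_alternant _

theorem rename_schurPoly {n : ℕ} (la : YoungDiagram) (s : Equiv.Perm (Fin n)) :
    rename s (schurPoly n la) = schurPoly n la := by
  by_cases h : la.colLen 0 ≤ n
  · have h1 := alternating_alternant (shifted n la) s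
    rw [← delta_mul_schurPoly h, map_mul, alternating_delta n s, smul_mul_assoc] at h1
    rcases Int.units_eq_one_or (Equiv.Perm.sign s) with h2 | h2
    · rw [h2] at h1
      simpa [delta_X_ne_zero] using h1
    · rw [h2] at h1
      simpa [delta_X_ne_zero] using h1
  · simp [schurPoly, h]

theorem Alternating.coeff {n : ℕ} {g : MvPolynomial (Fin n) ℤ} (hg : Alternating g)
    (s : Equiv.Perm (Fin n)) (d : Fin n →₀ ℕ) :
    g.coeff (d.mapDomain s) = (Equiv.Perm.sign s : ℤ) * g.coeff d := by
  have h := congrArg (MvPolynomial.coeff (d.mapDomain s)) (hg s)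
  rw [coeff_rename_mapDomain _ s.injective, coeff_smul, smul_eq_mul] at h
  rw [h, ← mul_assoc, ← Units.val_mul, Int.units_mul_self]
  simp

theorem Alternating.eq_zero {n : ℕ} {g : MvPolynomial (Fin n) ℤ} (hg : Alternating g)
    (h0 : ∀ d : Fin n →₀ ℕ, StrictAnti d → g.coeff d = 0) : g = 0 := by
  ext d
  rw [coeff_zero]
  by_cases hd : Function.Injective d
  · let s : Equiv.Perm (Fin n) := Fin.revPerm.trans (Tuple.sort d)
    have hs : StrictAnti (d ∘ s) := by
      have hm : StrictMono (d ∘ Tuple.sort d) :=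
        (Tuple.monotone_sort d).strictMono_of_injective (hd.comp (Tuple.sort d).injective)
      intro i j hij
      exact hm (Fin.rev_lt_rev.2 hij)
    have h1 := hg.coeff s⁻¹ d
    have h2 : ((d.mapDomain (s⁻¹ : Equiv.Perm (Fin n)) : Fin n →₀ ℕ) : Fin n → ℕ) = d ∘ s := by
      ext i
      have := Finsupp.mapDomain_apply (s⁻¹ : Equiv.Perm (Fin n)).injective d (s i)
      simpa using this
    rw [h0 _ (by rw [h2]; exact hs)] at h1
    rcases Int.units_eq_one_or (Equiv.Perm.sign s⁻¹) with h3 | h3 <;> rw [h3] at h1 <;>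
      simpa using h1.symm
  · simp only [Function.Injective, not_forall] at hd
    obtain ⟨i, j, hij, hne⟩ := hd
    have h1 := hg.coeff (Equiv.swap i j) d
    have h2 : d.mapDomain (Equiv.swap i j) = d := by
      ext k
      have := Finsupp.mapDomain_apply (Equiv.swap i j).injective d (Equiv.swap i j k)
      rw [Equiv.swap_apply_self] at this
      rw [this]
      rcases eq_or_ne k i with rfl | hki
      · simp [hij]
      rcases eq_or_ne k j with rfl | hkj
      · simp [hij]
      rw [Equiv.swap_apply_of_ne_of_ne hki hkj]
    rw [h2, Equiv.Perm.sign_swap hne] at h1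
    simp at h1
    omega

theorem strictAnti_unique {n : ℕ} {a b : Fin n → ℕ} (ha : StrictAnti a) (hb : StrictAnti b)
    (h : Set.range a = Set.range b) : a = b := by
  have h1 : a ∘ Fin.rev = b ∘ Fin.rev :=
    (StrictMono.range_inj (fun i j hij => ha (Fin.rev_lt_rev.2 hij))
      (fun i j hij => hb (Fin.rev_lt_rev.2 hij))).1 (by
        have e := fun f : Fin n → ℕ => (Fin.rev_surjective (n := n)).range_comp f
        exact (e a).trans (h.trans (e b).symm))
  ext i
  simpa using congrFun h1 i.rev

theorem coeff_alternant {n : ℕ} (a : Fin n → ℕ) (ha : StrictAnti a) (d : Fin n →₀ ℕ)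
    (hd : StrictAnti d) :
    (alternant (X : Fin n → MvPolynomial (Fin n) ℤ) a).coeff d = if (d : Fin n → ℕ) = a then 1 else 0 := by
  have hm : ∀ s : Equiv.Perm (Fin n), (∏ i, (X (s i) : MvPolynomial (Fin n) ℤ) ^ a i) =
      monomial (Finsupp.equivFunOnFinite.symm (a ∘ s.symm)) 1 := by
    intro s
    rw [monomial_eq, Finsupp.prod_fintype _ _ (by simp)]
    simp only [C_1, one_mul]
    exact Fintype.prod_equiv s _ _ (by simp)
  rw [alternant, Matrix.det_apply, coeff_sum]
  simp only [Matrix.of_apply, hm, Units.smul_def, coeff_smul, coeff_monomial]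
  have hs : ∀ s : Equiv.Perm (Fin n),
      Finsupp.equivFunOnFinite.symm (a ∘ s.symm) = d ↔ s = 1 ∧ (d : Fin n → ℕ) = a := by
    intro s
    constructor
    · intro h
      have h1 : (d : Fin n → ℕ) = a ∘ s.symm := by rw [← h]; rfl
      have h2 : (d : Fin n → ℕ) = a :=
        strictAnti_unique hd ha (by rw [h1, s.symm.surjective.range_comp])
      refine ⟨?_, h2⟩
      ext i : 1
      have := ha.injective (congrFun (h1.symm.trans h2) (s i))
      simpa using this.symm
    · rintro ⟨rfl, h⟩
      ext i
      rw [h]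
      rfl
  simp only [hs]
  by_cases h : (d : Fin n → ℕ) = a
  · simp [h]
  · simp [h]

theorem shifted_strictAnti (n : ℕ) (la : YoungDiagram) : StrictAnti (shifted n la) := by
  intro i j hij
  have := la.rowLen_anti i j hij.le
  have : (i : ℕ) < j := hij
  simp only [shifted]
  omega

theorem rowLen_eq_zero {la : YoungDiagram} {j : ℕ} (h : la.colLen 0 ≤ j) : la.rowLen j = 0 := by
  by_contra h1
  have h2 : (j, 0) ∈ la := YoungDiagram.mem_iff_lt_rowLen.2 (Nat.pos_of_ne_zero h1)
  have := YoungDiagram.mem_iff_lt_colLen.1 h2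
  omega

theorem eq_of_rowLen {la mu : YoungDiagram} (h : ∀ j, la.rowLen j = mu.rowLen j) : la = mu := by
  ext ⟨i, j⟩
  rw [YoungDiagram.mem_cells, YoungDiagram.mem_cells, YoungDiagram.mem_iff_lt_rowLen,
    YoungDiagram.mem_iff_lt_rowLen, h]

theorem shifted_inj {n : ℕ} {la mu : YoungDiagram} (hl : la.colLen 0 ≤ n) (hm : mu.colLen 0 ≤ n)
    (h : shifted n la = shifted n mu) : la = mu := by
  refine eq_of_rowLen fun j => ?_
  by_cases hj : j < n
  · have := congrFun h ⟨j, hj⟩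
    simpa [shifted] using this
  · rw [rowLen_eq_zero (hl.trans (not_lt.1 hj)), rowLen_eq_zero (hm.trans (not_lt.1 hj))]

theorem exists_shifted {n : ℕ} {d : Fin n → ℕ} (hd : StrictAnti d) :
    ∃ la : YoungDiagram, la.colLen 0 ≤ n ∧ shifted n la = d := by
  have hbd : ∀ (k : ℕ) (i : Fin n), (i : ℕ) + k + 1 = n → k ≤ d i := by
    intro k
    induction k with
    | zero => intros; omega
    | succ k ih =>
      intro i hi
      have h1 := ih ⟨i + 1, by omega⟩ (by simp only; omega)
      have h2 : d ⟨i + 1, by omega⟩ < d i := hd (by rw [Fin.lt_def]; simp)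
      omega
  have hstep : ∀ (k : ℕ) (i j : Fin n), (i : ℕ) + k = j → d j + k ≤ d i := by
    intro k
    induction k with
    | zero => intro i j h; have : i = j := Fin.ext (by omega); subst this; simp
    | succ k ih =>
      intro i j hij
      have h1 := ih ⟨i + 1, by omega⟩ j (by simp only; omega)
      have h2 : d ⟨i + 1, by omega⟩ < d i := hd (by rw [Fin.lt_def]; simp)
      omega
  have hanti : Antitone fun j : Fin n => d j - (n - 1 - j) := by
    intro i j hij
    have := hstep (j - i) i j (by have : (i : ℕ) ≤ j := hij; omega)
    have : (i : ℕ) ≤ j := hij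
    simp only
    omega
  let la := YoungDiagram.ofRowLens (List.ofFn fun j : Fin n => d j - (n - 1 - j))
    (List.sortedGE_ofFn_iff.2 hanti)
  refine ⟨la, ?_, ?_⟩
  · by_contra h
    have h1 : (n, 0) ∈ la := YoungDiagram.mem_iff_lt_colLen.2 (not_le.1 h)
    obtain ⟨h2, -⟩ := YoungDiagram.mem_ofRowLens.1 h1
    simp at h2
  · ext i
    have h1 : la.rowLen i = d i - (n - 1 - i) := by
      have := YoungDiagram.rowLen_ofRowLens (hw := List.sortedGE_ofFn_iff.2 hanti)
        (Fin.cast (List.length_ofFn (f := fun j : Fin n => d j - (n - 1 - j))).symm i)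
      simpa using this
    have := hbd (n - 1 - i) i (by omega)
    rw [shifted, h1]
    omega

theorem Alternating.expand {n : ℕ} {g : MvPolynomial (Fin n) ℤ} (hg : Alternating g)
    (S : Finset YoungDiagram) (hS : ∀ la : YoungDiagram, la.colLen 0 ≤ n →
      g.coeff (Finsupp.equivFunOnFinite.symm (shifted n la)) ≠ 0 → la ∈ S) :
    g = ∑ la ∈ S with la.colLen 0 ≤ n,
      g.coeff (Finsupp.equivFunOnFinite.symm (shifted n la)) • alternant X (shifted n la) := by
  rw [← sub_eq_zero]
  apply Alternating.eq_zero
  · intro s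
    rw [map_sub, map_sum, hg s, smul_sub, Finset.smul_sum]
    congr 1
    refine Finset.sum_congr rfl fun la _ => ?_
    rw [map_zsmul, alternating_alternant _ s, smul_comm]
  · intro d hd
    obtain ⟨ka, hk, hkd⟩ := exists_shifted hd
    have hde : d = Finsupp.equivFunOnFinite.symm (shifted n ka) := by
      rw [hkd]; ext; simp
    rw [coeff_sub, coeff_sum, sub_eq_zero]
    simp only [coeff_smul, coeff_alternant _ (shifted_strictAnti n _) d hd, smul_eq_mul, mul_ite,
      mul_one, mul_zero]
    by_cases hmem : ka ∈ S
    · rw [Finset.sum_eq_single ka]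
      · rw [if_pos hkd.symm, hde]
      · intro la hla hne
        rw [if_neg]
        intro h
        exact hne (shifted_inj (Finset.mem_filter.1 hla).2 hk (h.symm.trans hkd.symm))
      · intro h
        exact absurd (Finset.mem_filter.2 ⟨hmem, hk⟩) h
    · rw [Finset.sum_eq_zero]
      · by_contra h
        exact hmem (hS ka hk (hde ▸ h))
      · intro la hla
        rw [if_neg]
        intro h
        rw [shifted_inj (Finset.mem_filter.1 hla).2 hk (h.symm.trans hkd.symm)] at hla
        exact hmem (Finset.mem_filter.1 hla).1

theorem alternant_isHomogeneous {n : ℕ} (a : Fin n → ℕ) :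
    (alternant (X : Fin n → MvPolynomial (Fin n) ℤ) a).IsHomogeneous (∑ i, a i) := by
  rw [alternant, Matrix.det_apply]
  refine IsHomogeneous.sum _ _ _ fun s _ => ?_
  rw [Units.smul_def, zsmul_eq_mul, ← map_intCast (C : ℤ →+* MvPolynomial (Fin n) ℤ)]
  refine IsHomogeneous.C_mul ?_ _
  exact IsHomogeneous.prod _ _ _ fun i _ => by simpa using isHomogeneous_X_pow (s i) (a i)

attribute [local instance] MvPolynomial.gradedAlgebra in
theorem isHomogeneous_of_mul {n p q : ℕ} {f g : MvPolynomial (Fin n) ℤ} (hg : g.IsHomogeneous q)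
    (hg0 : g ≠ 0) (h : (f * g).IsHomogeneous (p + q)) : f.IsHomogeneous p := by
  intro d hd
  by_contra hne
  have key : homogeneousComponent (Finsupp.degree d) f * g = 0 := by
    have h1 := DirectSum.coe_decompose_mul_add_of_right_mem (homogeneousSubmodule (Fin n) ℤ)
      (i := Finsupp.degree d) (a := f) ((mem_homogeneousSubmodule _ _).2 hg)
    have h2 := DirectSum.decompose_of_mem_ne (homogeneousSubmodule (Fin n) ℤ)
      ((mem_homogeneousSubmodule _ _).2 h) (j := Finsupp.degree d + q) (by
        rw [Finsupp.degree_eq_weight_one] 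
        intro h; apply hne; exact (Nat.add_right_cancel h).symm)
    rw [h2] at h1
    rw [← decomposition.decompose'_apply]
    exact h1.symm
  have h3 := (mul_eq_zero.1 key).resolve_right hg0
  have h4 := congrArg (coeff d) h3
  rw [coeff_homogeneousComponent, if_pos rfl] at h4
  exact hd h4


/-- Setting the last variable to zero. -/
noncomputable def killLast (n : ℕ) : MvPolynomial (Fin (n + 1)) ℤ →ₐ[ℤ] MvPolynomial (Fin n) ℤ :=
  aeval (Fin.snoc (α := fun _ => MvPolynomial (Fin n) ℤ) X 0)

theorem coeff_killLast {n : ℕ} (g : MvPolynomial (Fin (n + 1)) ℤ) (e : Fin n → ℕ) :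
    (killLast n g).coeff (Finsupp.equivFunOnFinite.symm e) =
      g.coeff (Finsupp.equivFunOnFinite.symm (Fin.snoc (α := fun _ => ℕ) e 0)) := by
  induction g using MvPolynomial.induction_on' with
  | add p q hp hq => rw [map_add, coeff_add, coeff_add, hp, hq]
  | monomial d c =>
    have h1 : killLast n (monomial d c) = C c * ((∏ i : Fin n, X i ^ d i.castSucc) *
        0 ^ d (Fin.last n)) := by
      rw [killLast, aeval_monomial, Finsupp.prod_fintype _ _ (by simp), Fin.prod_univ_castSucc]
      simp
    have h2 : (∏ i : Fin n, (X i : MvPolynomial (Fin n) ℤ) ^ d i.castSucc) =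
        monomial (Finsupp.equivFunOnFinite.symm fun i : Fin n => d i.castSucc) 1 := by
      rw [monomial_eq, Finsupp.prod_fintype _ _ (by simp)]
      simp
    have h3 : d = Finsupp.equivFunOnFinite.symm (Fin.snoc (α := fun _ => ℕ) e 0) ↔
        (Finsupp.equivFunOnFinite.symm fun i : Fin n => d i.castSucc) =
          Finsupp.equivFunOnFinite.symm e ∧ d (Fin.last n) = 0 := by
      constructor
      · intro h
        rw [h]
        constructor
        · ext i; simp
        · simp
      · rintro ⟨h, h'⟩
        ext i
        induction i using Fin.lastCases with
        | last => simp [h']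
        | cast i => simpa using DFunLike.congr_fun h i
    rw [h1, h2, coeff_monomial]
    simp only [h3]
    by_cases h0 : d (Fin.last n) = 0
    · rw [h0, pow_zero, mul_one, coeff_C_mul, coeff_monomial]
      simp
    · simp [h0]

theorem killLast_alternant {n : ℕ} {la : YoungDiagram} (h : la.colLen 0 ≤ n) :
    killLast n (alternant X (shifted (n + 1) la)) = alternant X (shifted n la) * ∏ i, X i := by
  have hlast : la.rowLen n = 0 := rowLen_eq_zero h
  rw [alternant, AlgHom.map_det, Matrix.det_succ_row _ (Fin.last n), Finset.sum_eq_single (Fin.last n)]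
  · have hm := Matrix.det_mul_column (fun i : Fin n => (X i : MvPolynomial (Fin n) ℤ))
      (Matrix.of fun i j => X i ^ shifted n la j)
    rw [alternant, mul_comm (Matrix.det _), ← hm]
    have e1 : ((-1 : MvPolynomial (Fin n) ℤ)) ^ ((Fin.last n : ℕ) + (Fin.last n : ℕ)) = 1 :=
      Even.neg_one_pow ⟨_, rfl⟩
    rw [e1]
    simp only [one_mul, AlgHom.mapMatrix_apply, Matrix.map_apply, Matrix.of_apply, map_pow]
    have e2 : shifted (n + 1) la (Fin.last n) = 0 := by simp [shifted, hlast]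
    rw [e2, pow_zero, one_mul]
    congr 1
    ext i j : 2
    have e3 : shifted (n + 1) la j.castSucc = shifted n la j + 1 := by
      simp only [shifted, Fin.val_castSucc]; omega
    simp [killLast, e3, pow_succ']
  · intro j _ hj
    have : shifted (n + 1) la j ≠ 0 := by
      have : (j : ℕ) < n := Fin.val_lt_last hj
      simp only [shifted]; omega
    simp [killLast, this]
  · simp

theorem killLast_delta (n : ℕ) :
    killLast n (delta X) = delta X * ∏ i, X i := by
  have hb : (⊥ : YoungDiagram).colLen 0 ≤ n := by
    by_contra h
    exact YoungDiagram.notMem_bot _ (YoungDiagram.mem_iff_lt_colLen.2 (not_le.1 h))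
  have hs : ∀ m : ℕ, shifted m ⊥ = fun j : Fin m => m - 1 - (j : ℕ) := by
    intro m
    ext j
    have : (⊥ : YoungDiagram).rowLen j = 0 := by
      by_contra h
      exact YoungDiagram.notMem_bot _ (YoungDiagram.mem_iff_lt_rowLen.2 (Nat.pos_of_ne_zero h))
    simp [shifted, this]
  have := killLast_alternant hb
  rwa [hs, hs, ← delta_eq_alternant, ← delta_eq_alternant] at this

theorem killLast_schurPoly (n : ℕ) (la : YoungDiagram) :
    killLast n (schurPoly (n + 1) la) = schurPoly n la := by
  have hX : (∏ i, X i : MvPolynomial (Fin n) ℤ) ≠ 0 :=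
    Finset.prod_ne_zero_iff.2 fun i _ => X_ne_zero i
  have hD := mul_ne_zero (delta_X_ne_zero n) hX
  by_cases h : la.colLen 0 ≤ n
  · have h1 := congrArg (killLast n) (delta_mul_schurPoly (h.trans (Nat.le_succ n)))
    rw [map_mul, killLast_delta, killLast_alternant h, ← delta_mul_schurPoly h] at h1
    refine mul_left_cancel₀ hD (h1.trans ?_)
    ring
  · rw [schurPoly.eq_def n, if_neg h]
    by_cases h' : la.colLen 0 ≤ n + 1
    · have h1 := congrArg (killLast n) (delta_mul_schurPoly h')
      have hpos : 0 < la.rowLen n := YoungDiagram.mem_iff_lt_rowLen.1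
        (YoungDiagram.mem_iff_lt_colLen.2 (not_le.1 h))
      have h2 : killLast n (alternant X (shifted (n + 1) la)) = 0 := by
        rw [alternant, AlgHom.map_det]
        refine Matrix.det_eq_zero_of_row_eq_zero (Fin.last n) fun j => ?_
        have : shifted (n + 1) la j ≠ 0 := by
          have := la.rowLen_anti j n (Nat.le_of_lt_succ j.2)
          simp only [shifted]; omega
        simp [killLast, this]
      rw [map_mul, killLast_delta, h2] at h1
      exact (mul_eq_zero.1 h1).resolve_left hD
    · rw [schurPoly, if_neg h', map_zero]

theorem sum_rowLen {n : ℕ} {la : YoungDiagram} (h : la.colLen 0 ≤ n) :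
    ∑ j : Fin n, la.rowLen j = la.card := by
  rw [Fin.sum_univ_eq_sum_range (fun j => la.rowLen j) n, YoungDiagram.card,
    Finset.card_eq_sum_card_fiberwise (f := Prod.fst) (t := Finset.range n)]
  · exact Finset.sum_congr rfl fun j _ => la.rowLen_eq_card
  · rintro ⟨i, j⟩ hij
    have h1 := la.up_left_mem le_rfl (Nat.zero_le j) hij
    have := YoungDiagram.mem_iff_lt_colLen.1 h1
    simp only [Finset.coe_range, Set.mem_Iio]
    omega

theorem sum_shifted {n : ℕ} {la : YoungDiagram} (h : la.colLen 0 ≤ n) :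
    ∑ j, shifted n la j = la.card + ∑ j : Fin n, (n - 1 - j) := by
  simp only [shifted]
  rw [Finset.sum_add_distrib, sum_rowLen h]

theorem finite_card_eq (d : ℕ) : {la : YoungDiagram | la.card = d}.Finite := by
  refine Set.Finite.of_finite_image (f := YoungDiagram.cells)
    ((Finset.finite_toSet (Finset.range (d + 1) ×ˢ Finset.range (d + 1)).powerset).subset ?_)
    (fun a _ b _ h => YoungDiagram.ext h)
  rintro _ ⟨la, rfl, rfl⟩
  rw [Finset.mem_coe, Finset.mem_powerset]
  rintro ⟨i, j⟩ hij
  rw [YoungDiagram.mem_cells] at hij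
  have h1 : la.rowLen i ≤ la.card := by
    rw [YoungDiagram.rowLen_eq_card]; exact Finset.card_le_card (Finset.filter_subset _ _)
  have h2 : la.colLen j ≤ la.card := by
    rw [YoungDiagram.colLen_eq_card]; exact Finset.card_le_card (Finset.filter_subset _ _)
  have h3 := YoungDiagram.mem_iff_lt_rowLen.1 hij
  have h4 := YoungDiagram.mem_iff_lt_colLen.1 hij
  simp only [Finset.mem_product, Finset.mem_range]
  omega

theorem colLen_le_card (la : YoungDiagram) : la.colLen 0 ≤ la.card := by
  rw [YoungDiagram.colLen_eq_card]; exact Finset.card_le_card (Finset.filter_subset _ _)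

theorem coeff_stable (mu nu la : YoungDiagram) {n : ℕ} (h : la.colLen 0 ≤ n) :
    (schurPoly (n + 1) mu * schurPoly (n + 1) nu * delta X).coeff
        (Finsupp.equivFunOnFinite.symm (shifted (n + 1) la)) =
      (schurPoly n mu * schurPoly n nu * delta X).coeff
        (Finsupp.equivFunOnFinite.symm (shifted n la)) := by
  have h1 : shifted (n + 1) la =
      Fin.snoc (α := fun _ => ℕ) (fun j => shifted n la j + 1) 0 := by
    ext i
    induction i using Fin.lastCases with
    | last => simp [shifted, rowLen_eq_zero h]
    | cast j => simp only [shifted, Fin.val_castSucc, Fin.snoc_castSucc]; omega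
  rw [h1, ← coeff_killLast, map_mul, map_mul, killLast_delta, killLast_schurPoly,
    killLast_schurPoly, ← mul_assoc]
  have h2 : (∏ i, X i : MvPolynomial (Fin n) ℤ) =
      monomial (Finsupp.equivFunOnFinite.symm fun _ => 1) 1 := by
    rw [monomial_eq, Finsupp.prod_fintype _ _ (by simp)]
    simp
  have h3 : (Finsupp.equivFunOnFinite.symm fun j => shifted n la j + 1) =
      Finsupp.equivFunOnFinite.symm (shifted n la) +
        Finsupp.equivFunOnFinite.symm fun _ : Fin n => 1 := by
    ext i; simp
  rw [h2, h3, coeff_mul_monomial, mul_one]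

theorem exists_littlewoodRichardson_aux (mu nu : YoungDiagram) :
    ∃ c : YoungDiagram →₀ ℤ, (∀ la, c la ≠ 0 → la.card = mu.card + nu.card) ∧ ∀ n : ℕ,
      schurPoly n mu * schurPoly n nu = c.sum fun la a => a • schurPoly n la := by
  classical
  let F : (n : ℕ) → MvPolynomial (Fin n) ℤ := fun n => schurPoly n mu * schurPoly n nu * delta X
  let K : ℕ → YoungDiagram → ℤ := fun n la =>
    (F n).coeff (Finsupp.equivFunOnFinite.symm (shifted n la))
  have hK : ∀ (la : YoungDiagram) (n : ℕ), la.colLen 0 ≤ n → K n la = K (la.colLen 0) la := by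
    intro la n hn
    induction n, hn using Nat.le_induction with
    | base => rfl
    | succ n hn ih => rw [← ih]; exact coeff_stable mu nu la hn
  have halt : ∀ n, Alternating (F n) := by
    intro n s
    simp only [F]
    rw [map_mul, map_mul, rename_schurPoly, rename_schurPoly, alternating_delta n s, mul_smul_comm]
  have hcard : ∀ (n : ℕ) (la : YoungDiagram), la.colLen 0 ≤ n → K n la ≠ 0 →
      la.card = mu.card + nu.card := by
    intro n la hn hne
    by_cases hm : mu.colLen 0 ≤ n
    · by_cases hv : nu.colLen 0 ≤ n
      · have h1 : (F n * delta X).IsHomogeneous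
            ((mu.card + nu.card + ∑ j : Fin n, (n - 1 - j)) + ∑ j : Fin n, (n - 1 - j)) := by
          have h2 := (alternant_isHomogeneous (shifted n mu)).mul
            (alternant_isHomogeneous (shifted n nu))
          rw [← delta_mul_schurPoly hm, ← delta_mul_schurPoly hv, sum_shifted hm,
            sum_shifted hv] at h2
          convert h2 using 1
          · simp only [F]; ring
          · ring
        have h3 : (delta (X : Fin n → MvPolynomial (Fin n) ℤ)).IsHomogeneous
            (∑ j : Fin n, (n - 1 - j)) := by
          rw [delta_eq_alternant]; exact alternant_isHomogeneous _
        have h4 := isHomogeneous_of_mul h3 (delta_X_ne_zero n) h1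
        have h5 : Finsupp.degree (Finsupp.equivFunOnFinite.symm (shifted n la)) =
            mu.card + nu.card + ∑ j : Fin n, (n - 1 - j) := by
          by_contra h
          exact hne (h4.coeff_eq_zero h)
        rw [Finsupp.degree_eq_sum] at h5
        simp only [Finsupp.equivFunOnFinite_symm_apply_apply] at h5
        rw [sum_shifted hn] at h5
        omega
      · exact absurd (by simp [K, F, schurPoly.eq_def n nu, hv]) hne
    · exact absurd (by simp [K, F, schurPoly.eq_def n mu, hm]) hne
  let S : Finset YoungDiagram := (finite_card_eq (mu.card + nu.card)).toFinset
  refine ⟨Finsupp.onFinset S (fun la => K (la.colLen 0) la) fun la h => ?_,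
    fun la h => hcard _ la le_rfl h, fun n => ?_⟩
  · simp only [S, Set.Finite.mem_toFinset, Set.mem_ofPred_eq]
    exact hcard _ la le_rfl h
  · rw [Finsupp.onFinset_sum _ (by simp)]
    refine mul_right_cancel₀ (delta_X_ne_zero n) ?_
    have h1 := (halt n).expand S (fun la hl h => by
      simp only [S, Set.Finite.mem_toFinset, Set.mem_ofPred_eq]
      exact hcard n la hl h)
    refine h1.trans ?_
    rw [Finset.sum_mul, Finset.sum_filter]
    refine Finset.sum_congr rfl fun la _ => ?_
    by_cases hl : la.colLen 0 ≤ n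
    · rw [if_pos hl, ← delta_mul_schurPoly hl, smul_mul_assoc, mul_comm (schurPoly n la)]
      congr 1
      exact hK la n hl
    · rw [if_neg hl]
      simp [schurPoly, hl]

/-- Schur polynomials are linearly independent. -/
theorem eq_zero_of_sum_schurPoly (c : YoungDiagram →₀ ℤ)
    (h : ∀ n : ℕ, (c.sum fun la a => a • schurPoly n la) = 0) : c = 0 := by
  classical
  ext ka
  let n := c.support.sup (fun la => la.colLen 0) ⊔ ka.colLen 0
  have hk : ka.colLen 0 ≤ n := le_sup_right
  have hn : ∀ la ∈ c.support, la.colLen 0 ≤ n := fun la hla =>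
    (Finset.le_sup (f := fun la : YoungDiagram => la.colLen 0) hla).trans le_sup_left
  have h1 := congrArg (fun p => (delta X * p).coeff
    (Finsupp.equivFunOnFinite.symm (shifted n ka))) (h n)
  simp only [Finsupp.sum, Finset.mul_sum, mul_zero, coeff_zero, coeff_sum, mul_smul_comm,
    coeff_smul, smul_eq_mul] at h1
  have h2 : ∀ la ∈ c.support, c la * (delta X * schurPoly n la).coeff
      (Finsupp.equivFunOnFinite.symm (shifted n ka)) = if la = ka then c la else 0 := by
    intro la hla
    rw [delta_mul_schurPoly (hn la hla), coeff_alternant _ (shifted_strictAnti n la) _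
      (shifted_strictAnti n ka)]
    by_cases hlk : la = ka
    · simp [hlk]
    · have : ¬ shifted n ka = shifted n la := fun e => hlk (shifted_inj (hn la hla) hk e.symm)
      simp [hlk, this]
  rw [Finset.sum_congr rfl h2, Finset.sum_ite_eq'] at h1
  by_cases hm : ka ∈ c.support
  · simpa [hm] using h1
  · simpa using hm

theorem existsUnique_littlewoodRichardson (mu nu : YoungDiagram) :
    ∃! c : YoungDiagram →₀ ℤ, ∀ n : ℕ,
      schurPoly n mu * schurPoly n nu = c.sum fun la a => a • schurPoly n la := by
  obtain ⟨c, -, hc⟩ := exists_littlewoodRichardson_aux mu nu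
  refine ⟨c, hc, fun c' hc' => ?_⟩
  rw [← sub_eq_zero]
  refine eq_zero_of_sum_schurPoly _ fun n => ?_
  rw [Finsupp.sum_sub_index fun la a b => sub_smul a b _, ← hc, ← hc', sub_self]

/-- The Littlewood-Richardson coefficient `c^la_{mu nu}`: the integers with
`s_mu s_nu = ∑_la c^la_{mu nu} s_la` in any number of variables. -/
noncomputable def littlewoodRichardson (la mu nu : YoungDiagram) : ℤ :=
  Classical.choose (existsUnique_littlewoodRichardson mu nu).exists la

theorem card_eq_of_littlewoodRichardson_ne_zero {la mu nu : YoungDiagram}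
    (h : littlewoodRichardson la mu nu ≠ 0) : la.card = mu.card + nu.card := by
  obtain ⟨c, hc, hc'⟩ := exists_littlewoodRichardson_aux mu nu
  have := (existsUnique_littlewoodRichardson mu nu).unique hc'
    (Classical.choose_spec (existsUnique_littlewoodRichardson mu nu).exists)
  rw [littlewoodRichardson, ← this] at h
  exact hc la h

/-- The Schur function `s_la(x)`. -/
noncomputable def schur {R : Type*} [CommRing R] {n : ℕ} (la : YoungDiagram) (x : Fin n → R) : R :=
  aeval x (schurPoly n la)

/-- The Littlewood-Schur function
`LS_la(x; y) = ∑_{mu, nu} c^la_{mu nu} s_mu(x) s_{nu'}(y)`; the sum has finite support by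
`finite_support_littlewoodSchur`. -/
noncomputable def littlewoodSchur {R : Type*} [CommRing R] {n m : ℕ} (la : YoungDiagram)
    (x : Fin n → R) (y : Fin m → R) : R :=
  ∑ᶠ p : YoungDiagram × YoungDiagram,
    (littlewoodRichardson la p.1 p.2 : R) * schur p.1 x * schur p.2.transpose y

theorem finite_support_littlewoodSchur {R : Type*} [CommRing R] {n m : ℕ} (la : YoungDiagram)
    (x : Fin n → R) (y : Fin m → R) :
    (Function.support fun p : YoungDiagram × YoungDiagram =>
      (littlewoodRichardson la p.1 p.2 : R) * schur p.1 x * schur p.2.transpose y).Finite := by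
  have hfin : {mu : YoungDiagram | mu.card ≤ la.card}.Finite := by
    have : {mu : YoungDiagram | mu.card ≤ la.card} =
        ⋃ d ∈ Finset.range (la.card + 1), {mu : YoungDiagram | mu.card = d} := by
      ext mu; simp
    rw [this]
    exact Set.Finite.biUnion (Finset.finite_toSet _) fun d _ => finite_card_eq d
  refine (hfin.prod hfin).subset fun p hp => ?_
  have h0 : littlewoodRichardson la p.1 p.2 ≠ 0 := by
    intro h
    exact hp (by simp [h])
  have := card_eq_of_littlewoodRichardson_ne_zero h0
  simp only [Set.mem_prod, Set.mem_ofPred_eq]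
  omega

/-- Littlewood-Schur functions extended to the symbol `∞`, here `⊤`, by `LS_∞ = 0`. -/
noncomputable def littlewoodSchurTop {R : Type*} [CommRing R] {n m : ℕ} :
    WithTop YoungDiagram → (Fin n → R) → (Fin m → R) → R
  | none, _, _ => 0
  | some la, x, y => littlewoodSchur la x y

/-- The point `(i, j)` lies in the Ferrers diagram of `la`, that is, `1 ≤ j` and
`1 ≤ i ≤ la_j`. -/
def MemFerrers (i j : ℤ) (la : YoungDiagram) : Prop :=
  1 ≤ j ∧ 1 ≤ i ∧ i ≤ la.rowLen (j - 1).toNat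

/-- `k` is the `(m, n)`-index of `la`: the largest integer `k ≤ min m n`, possibly negative, with
`(m + 1 - k, n + 1 - k) ∉ la`. -/
def IsIndex (la : YoungDiagram) (m n : ℕ) (k : ℤ) : Prop :=
  IsGreatest {k : ℤ | k ≤ min (m : ℤ) n ∧ ¬ MemFerrers (m + 1 - k) (n + 1 - k) la} k

theorem exists_isIndex (la : YoungDiagram) (m n : ℕ) : ∃ k, IsIndex la m n k := by
  have hb : ∀ k : ℤ, k ≤ min (m : ℤ) n ∧ ¬ MemFerrers (m + 1 - k) (n + 1 - k) la →
      k ≤ min (m : ℤ) n := fun k h => h.1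
  have hne : ∃ k : ℤ, k ≤ min (m : ℤ) n ∧ ¬ MemFerrers (m + 1 - k) (n + 1 - k) la := by
    refine ⟨-(la.rowLen 0 : ℤ), by omega, fun h => ?_⟩
    have h1 := h.2.2
    have h2 := la.rowLen_anti 0 ((n + 1 - -(la.rowLen 0 : ℤ)) - 1).toNat (Nat.zero_le _)
    omega
  obtain ⟨k, hk, hmax⟩ := Int.exists_greatest_of_bdd ⟨_, hb⟩ hne
  exact ⟨k, hk, fun z hz => hmax z hz⟩

/-- The partition `mu + ⟨k^l⟩` for a partition `mu` of length at most `l` and an integer `k` with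
`mu_j + k ≥ 0` for `1 ≤ j ≤ l`: the sequence `(mu_1 + k, …, mu_l + k)`. -/
def addRect (mu : YoungDiagram) (k : ℤ) (l : ℕ) : YoungDiagram :=
  YoungDiagram.ofRowLens (List.ofFn fun j : Fin l => ((mu.rowLen j : ℤ) + k).toNat)
    (List.sortedGE_ofFn_iff.2 fun i j hij => by
      have := mu.rowLen_anti i j hij
      show ((mu.rowLen j : ℤ) + k).toNat ≤ ((mu.rowLen i : ℤ) + k).toNat
      omega)

/-- The partition `nu_{[r]} = (nu_1, …, nu_r)`. -/
def initialParts (nu : YoungDiagram) (r : ℕ) : YoungDiagram :=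
  YoungDiagram.ofRowLens (nu.rowLens.take r) (List.sortedGE_iff_pairwise.2
    ((List.sortedGE_iff_pairwise.1 nu.rowLens_sorted).sublist (List.take_sublist r _)))

/-- The partition `nu_{(r+1, r+2, …)}`. -/
def remainingParts (nu : YoungDiagram) (r : ℕ) : YoungDiagram :=
  YoungDiagram.ofRowLens (nu.rowLens.drop r) (List.sortedGE_iff_pairwise.2
    ((List.sortedGE_iff_pairwise.1 nu.rowLens_sorted).sublist (List.drop_sublist r _)))

/-- The union of two partitions: the partition whose parts are those of `la` and those of `mu`,
with multiplicities. If appending the parts of `mu` to those of `la` gives a partition, it is this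
one. -/
def union (la mu : YoungDiagram) : YoungDiagram :=
  YoungDiagram.ofRowLens ((la.rowLens ++ mu.rowLens).insertionSort (· ≥ ·))
    List.sortedGE_insertionSort

/-- The sequence `(mu + ρ_m) ∪ (nu + ρ_n)`, of length `m + n`. -/
def overlapSeq (m n : ℕ) (mu nu : YoungDiagram) : Fin (m + n) → ℕ :=
  Fin.append (shifted m mu) (shifted n nu)

/-- `la` has length at most `m + n`, and the permutation `s` turns the sequence
`(mu + ρ_m) ∪ (nu + ρ_n)` into `la + ρ_{m+n}`. -/
def IsOverlap (m n : ℕ) (mu nu la : YoungDiagram) (s : Equiv.Perm (Fin (m + n))) : Prop :=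
  la.colLen 0 ≤ m + n ∧ ∀ i, shifted (m + n) la i = overlapSeq m n mu nu (s i)

theorem IsOverlap.unique {m n : ℕ} {mu nu la la' : YoungDiagram} {s s' : Equiv.Perm (Fin (m + n))}
    (h : IsOverlap m n mu nu la s) (h' : IsOverlap m n mu nu la' s') : la = la' ∧ s = s' := by
  have e1 : shifted (m + n) la = overlapSeq m n mu nu ∘ s := funext h.2
  have e2 : shifted (m + n) la' = overlapSeq m n mu nu ∘ s' := funext h'.2
  have e3 : shifted (m + n) la = shifted (m + n) la' :=
    strictAnti_unique (shifted_strictAnti _ _) (shifted_strictAnti _ _) (by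
      rw [e1, e2, s.surjective.range_comp, s'.surjective.range_comp])
  refine ⟨shifted_inj h.1 h'.1 e3, ?_⟩
  have hinj : Function.Injective (overlapSeq m n mu nu) := by
    have h1 := (shifted_strictAnti (m + n) la).injective
    rw [e1] at h1
    exact (Function.Injective.of_comp_iff' _ s.bijective).1 h1
  ext i : 1
  exact hinj (by rw [← h.2 i, ← h'.2 i, e3])

open Classical in
/-- The `(m, n)`-overlap of `mu` and `nu` (partitions of length at most `m` and `n`): the partition
`la` such that `la + ρ_{m+n}` is `(mu + ρ_m) ∪ (nu + ρ_n)` up to reordering if it exists, and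
`∞`, here `⊤`, otherwise. -/
noncomputable def overlap (m n : ℕ) (mu nu : YoungDiagram) : WithTop YoungDiagram :=
  if h : ∃ la s, IsOverlap m n mu nu la s then ((Classical.choose h : YoungDiagram) :
    WithTop YoungDiagram) else ⊤

open Classical in
/-- The sign `ε_{m,n}(mu, nu)` of the overlap: the sign of the sorting permutation if the overlap
is a partition, and `1` otherwise. -/
noncomputable def overlapSign (m n : ℕ) (mu nu : YoungDiagram) : ℤ :=
  if h : ∃ s la, IsOverlap m n mu nu la s then
    (Equiv.Perm.sign (Classical.choose h) : ℤ) else 1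

/-- The subsequence of `x` with index set `K`. -/
def subseq {R : Type*} {n : ℕ} (x : Fin n → R) (K : Finset (Fin n)) : Fin K.card → R :=
  fun i => x (K.orderEmbOfFin rfl i)

/-- `Δ(x; y) = ∏_{i, j} (x_i - y_j)`. -/
def crossDelta {R : Type*} [CommRing R] {n m : ℕ} (x : Fin n → R) (y : Fin m → R) : R :=
  ∏ i, ∏ j, (x i - y j)

end LittlewoodSchur

open LittlewoodSchur

namespace LittlewoodSchur

/-! Both sides are evaluations of one determinant. If `H` is the power series `∏ (1 + y_j t) / ∏ (1
- z_p t)` with coefficients `h_r`, then `LS_λ(z; y) = det (h_{λ_i - i + j})` of any size `N ≥ l(λ)`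
(`littlewoodSchur_eq_jacobiTrudi`). For Schur functions this is the Jacobi-Trudi identity. The
general case combines it with the dual identity for `s_{ν'}(y)` and with the fact that the
Littlewood-Richardson coefficients also govern `H ↦ H * G` (`jacobiTrudi_mul`), which follows from
expanding `∏ H(u_i)` in Schur functions of auxiliary variables `u`.

Such a determinant depends only on the exponents `λ + ρ` that label its rows: permuting them
produces a sign and a repetition makes it vanish. Take `z = -x` and the exponents of `μ`, shifted by
`q`, followed by those of `ν`. Sorting them gives the left-hand side times `ε`; if the overlap is
`∞`, two rows agree and the determinant is `0`. The index of `ν` and that of `μ + ⟨k^l⟩` together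
ensure that the tail of `ν` lies below the overlap, so that only the first `l + r` rows need sorting
(`shifted_union`).

The right-hand side is a Laplace expansion of the same determinant along its first `l` rows
(`jacobiTrudi_append`). The index `0` of `μ + ⟨k^l⟩` says that its parts are at least `m`. The
entries in those rows are then of high enough degree for partial fractions to apply without a
polynomial part: each row is a linear combination of the rows `(z_p^j)_j`. By Cauchy-Binet the
determinant becomes a sum over `l`-subsets `K`. For fixed `K`, column operations with the
coefficients of `∏_{q ∈ K} (1 - z_q t)` clear the upper right block and replace `H` by the series of
the complementary variables (`det_append_pow`). The partial fraction weights contribute `∏ (z_s -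
z_t)⁻¹`, which is `1 / Δ(T; S)`. -/

/-- The determinant of the matrix with rows `(h_{a_i - N + 1}, …, h_{a_i})`, where `h_r` are the
coefficients of the power series `H`. -/
noncomputable def jacobiTrudi {R : Type*} [CommRing R] {N : ℕ} (H : PowerSeries R)
    (a : Fin N → ℕ) : R :=
  Matrix.det (Matrix.of fun i j : Fin N =>
    PowerSeries.coeff (a i) (PowerSeries.X ^ (N - 1 - (j : ℕ)) * H))

/-- The geometric series `1 / (1 - x t)`. -/
noncomputable def geomSeries {R : Type*} [CommRing R] (x : R) : PowerSeries R :=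
  PowerSeries.mk fun k => x ^ k

/-- The generating series `∏ 1 / (1 - x_i t)` of the complete symmetric functions. -/
noncomputable def completeSeries {R : Type*} [CommRing R] {n : ℕ} (x : Fin n → R) :
    PowerSeries R :=
  ∏ i, geomSeries (x i)

/-- The generating series `∏ (1 + y_j t)` of the elementary symmetric functions. -/
noncomputable def elementarySeries {R : Type*} [CommRing R] {n : ℕ} (y : Fin n → R) :
    PowerSeries R :=
  ∏ j, (1 + PowerSeries.C (y j) * PowerSeries.X)

/-! ### The Jacobi-Trudi identity for Schur functions. -/

section Basic

variable {R S : Type*} [CommRing R] [CommRing S]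

theorem geomSeries_mul (x : R) :
    geomSeries x * (1 - PowerSeries.C x * PowerSeries.X) = 1 := by
  ext k
  cases k with
  | zero => simp [geomSeries, mul_sub]
  | succ k =>
    rw [mul_sub, mul_one, mul_left_comm, map_sub, PowerSeries.coeff_C_mul,
      PowerSeries.coeff_succ_mul_X]
    simp [geomSeries, pow_succ', PowerSeries.coeff_one]

theorem map_geomSeries (f : R →+* S) (x : R) :
    PowerSeries.map f (geomSeries x) = geomSeries (f x) := by
  ext k; simp [geomSeries]

theorem map_completeSeries (f : R →+* S) {n : ℕ} (x : Fin n → R) :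
    PowerSeries.map f (completeSeries x) = completeSeries fun i => f (x i) := by
  simp [completeSeries, map_prod, map_geomSeries]

theorem constantCoeff_completeSeries {n : ℕ} (x : Fin n → R) :
    PowerSeries.constantCoeff (completeSeries x) = 1 := by
  rw [completeSeries, map_prod]
  exact Finset.prod_eq_one fun i _ => by
    simp [geomSeries, ← PowerSeries.coeff_zero_eq_constantCoeff_apply]

theorem constantCoeff_elementarySeries {n : ℕ} (y : Fin n → R) :
    PowerSeries.constantCoeff (elementarySeries y) = 1 := by
  simp [elementarySeries, map_prod]

theorem map_jacobiTrudi (f : R →+* S) {N : ℕ} (H : PowerSeries R) (a : Fin N → ℕ) :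
    f (jacobiTrudi H a) = jacobiTrudi (PowerSeries.map f H) a := by
  rw [jacobiTrudi, jacobiTrudi, RingHom.map_det]
  congr 1
  ext i j
  simp only [RingHom.mapMatrix_apply, Matrix.map_apply, Matrix.of_apply]
  rw [← PowerSeries.coeff_map, map_mul, map_pow, PowerSeries.map_X]

theorem jacobiTrudi_comp_perm {N : ℕ} (H : PowerSeries R) (a : Fin N → ℕ)
    (s : Equiv.Perm (Fin N)) :
    jacobiTrudi H (a ∘ s) = ((Equiv.Perm.sign s : ℤ) : R) * jacobiTrudi H a := by
  rw [jacobiTrudi, jacobiTrudi, ← Matrix.det_permute s (Matrix.of fun i j : Fin N =>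
    PowerSeries.coeff (a i) (PowerSeries.X ^ (N - 1 - (j : ℕ)) * H))]
  rfl

theorem jacobiTrudi_eq_zero {N : ℕ} (H : PowerSeries R) {a : Fin N → ℕ}
    (ha : ¬ Function.Injective a) : jacobiTrudi H a = 0 := by
  simp only [Function.Injective, not_forall] at ha
  obtain ⟨i, j, hij, hne⟩ := ha
  exact Matrix.det_zero_of_row_eq hne (by ext k; simp [hij])

/-- The last exponent is `0`, so the last row consists of the constant terms of `t^N H, …, t H, H`,
which are `0, …, 0, 1`. Deleting the last row and column lowers the other exponents by one. -/
theorem jacobiTrudi_succ {N : ℕ} {H : PowerSeries R} (hH : PowerSeries.constantCoeff H = 1)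
    {la : YoungDiagram} (h : la.colLen 0 ≤ N) :
    jacobiTrudi H (shifted (N + 1) la) = jacobiTrudi H (shifted N la) := by
  rw [jacobiTrudi, Matrix.det_succ_row _ (Fin.last N), Finset.sum_eq_single (Fin.last N)]
  · have e2 : shifted (N + 1) la (Fin.last N) = 0 := by simp [shifted, rowLen_eq_zero h]
    have e1 : (-1 : R) ^ ((Fin.last N : ℕ) + (Fin.last N : ℕ)) = 1 := Even.neg_one_pow ⟨_, rfl⟩
    rw [e1, Matrix.of_apply, e2]
    simp only [Fin.val_last, Nat.add_sub_cancel, Nat.sub_self, pow_zero, one_mul,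
      PowerSeries.coeff_zero_eq_constantCoeff_apply, hH, jacobiTrudi]
    congr 1
    ext i j
    have e3 : shifted (N + 1) la i.castSucc = shifted N la i + 1 := by
      simp only [shifted, Fin.val_castSucc]; omega
    have e4 : N - (j : ℕ) = (N - 1 - j) + 1 := by omega
    simp only [Matrix.submatrix_apply, Fin.succAbove_last, Matrix.of_apply, e3, Fin.val_castSucc]
    rw [e4, pow_succ', mul_assoc, PowerSeries.coeff_succ_X_mul]
  · intro j _ hj
    have e2 : shifted (N + 1) la (Fin.last N) = 0 := by simp [shifted, rowLen_eq_zero h]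
    have : (j : ℕ) < N := Fin.val_lt_last hj
    have e4 : N + 1 - 1 - (j : ℕ) ≠ 0 := by omega
    rw [Matrix.of_apply, e2, PowerSeries.coeff_zero_eq_constantCoeff_apply]
    rw [map_mul, map_pow, PowerSeries.constantCoeff_X, zero_pow e4]
    simp
  · simp

theorem jacobiTrudi_stable {N : ℕ} {H : PowerSeries R} (hH : PowerSeries.constantCoeff H = 1)
    {la : YoungDiagram} (h : la.colLen 0 ≤ N) {M : ℕ} (hM : N ≤ M) :
    jacobiTrudi H (shifted M la) = jacobiTrudi H (shifted N la) := by
  induction M, hM using Nat.le_induction with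
  | base => rfl
  | succ M hM ih => rw [jacobiTrudi_succ hH (h.trans hM), ih]

theorem coe_eq_sum_range {Q : Polynomial R} {n : ℕ} (hQ : Q.natDegree < n) :
    (Q : PowerSeries R) = ∑ j ∈ Finset.range n,
      PowerSeries.C (Q.coeff j) * PowerSeries.X ^ j := by
  conv_lhs => rw [Q.as_sum_range' n hQ]
  rw [← Polynomial.coeToPowerSeries.ringHom_apply, map_sum]
  refine Finset.sum_congr rfl fun j _ => ?_
  rw [Polynomial.coeToPowerSeries.ringHom_apply, Polynomial.coe_monomial,
    PowerSeries.monomial_eq_C_mul_X_pow]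

/-- This exhibits multiplication by a polynomial of degree below `N` as a column operation on the
Jacobi-Trudi matrix. -/
theorem coeff_mul_polynomial {N : ℕ} {Q : Polynomial R} (hQ : Q.natDegree < N)
    (H : PowerSeries R) (a : ℕ) :
    PowerSeries.coeff a (H * (Q : PowerSeries R)) = ∑ j : Fin N,
      PowerSeries.coeff a (PowerSeries.X ^ (N - 1 - (j : ℕ)) * H) * Q.coeff (N - 1 - j) := by
  rw [coe_eq_sum_range hQ, ← Finset.sum_range_reflect, Finset.mul_sum, map_sum, Finset.sum_range]
  refine Finset.sum_congr rfl fun j _ => ?_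
  rw [mul_left_comm, PowerSeries.coeff_C_mul, mul_comm, mul_comm H]

/-- Since `1 / (1 - x_p t)` is the complete series times `Q_p = ∏_{q ≠ p} (1 - x_q t)`, the matrix
`(x_p ^ a_i)` is the Jacobi-Trudi matrix times a matrix `M` that does not depend on `a`. For `a = ρ`
the Jacobi-Trudi matrix is unitriangular, whence `det M = Δ(x)`. -/
theorem alternant_eq_delta_mul_jacobiTrudi {n : ℕ} (x : Fin n → R) (a : Fin n → ℕ) :
    alternant x a = delta x * jacobiTrudi (completeSeries x) a := by
  let Q : Fin n → Polynomial R := fun p =>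
    ∏ q ∈ Finset.univ.erase p, (1 - Polynomial.C (x q) * Polynomial.X)
  have hQ : ∀ p, (Q p).natDegree < n := by
    intro p
    refine (Polynomial.natDegree_prod_le _ _).trans_lt ?_
    refine (Finset.sum_le_card_nsmul _ _ 1 fun q _ => ?_).trans_lt ?_
    · exact (Polynomial.natDegree_sub_le _ _).trans (by
        simpa using (Polynomial.natDegree_C_mul_le (x q) Polynomial.X).trans
          Polynomial.natDegree_X_le)
    · have := p.pos
      simp [Finset.card_erase_of_mem]
      omega
  let M : Matrix (Fin n) (Fin n) R := Matrix.of fun j p => (Q p).coeff (n - 1 - j)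
  have hgen : ∀ p, completeSeries x * (Q p : PowerSeries R) = geomSeries (x p) := by
    intro p
    have h1 : (Q p : PowerSeries R) =
        ∏ q ∈ Finset.univ.erase p, (1 - PowerSeries.C (x q) * PowerSeries.X) := by
      simp only [Q]
      rw [← Polynomial.coeToPowerSeries.ringHom_apply, map_prod]
      simp
    rw [completeSeries, ← Finset.mul_prod_erase _ _ (Finset.mem_univ p), h1, mul_assoc,
      ← Finset.prod_mul_distrib]
    simp [geomSeries_mul]
  have key : ∀ b : Fin n → ℕ, alternant x b = jacobiTrudi (completeSeries x) b * M.det := by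
    intro b
    rw [jacobiTrudi, ← Matrix.det_mul, alternant, ← Matrix.det_transpose]
    congr 1
    ext i p
    rw [Matrix.mul_apply, Matrix.transpose_apply, Matrix.of_apply]
    have h1 := coeff_mul_polynomial (hQ p) (completeSeries x) (b i)
    rw [hgen, geomSeries, PowerSeries.coeff_mk] at h1
    exact h1
  have h1 : jacobiTrudi (completeSeries x) (fun j : Fin n => n - 1 - (j : ℕ)) = 1 := by
    rw [jacobiTrudi, Matrix.det_of_isUpperTriangular]
    · refine Finset.prod_eq_one fun i _ => ?_
      have := PowerSeries.coeff_X_pow_mul (completeSeries x) (n - 1 - (i : ℕ)) 0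
      rw [zero_add] at this
      rw [Matrix.of_apply, this, PowerSeries.coeff_zero_eq_constantCoeff_apply,
        constantCoeff_completeSeries]
    · intro i j hij
      have : (j : ℕ) < i := hij
      rw [Matrix.of_apply, PowerSeries.coeff_X_pow_mul', if_neg (by omega)]
  have h2 := key fun j => n - 1 - (j : ℕ)
  rw [h1, one_mul, ← delta_eq_alternant] at h2
  rw [key a, h2, mul_comm]

-- `Δ` can be cancelled for indeterminates over `ℤ`; the identity then specializes to arbitrary
-- elements of `R`, distinct or not.
open MvPolynomial in
theorem schur_eq_jacobiTrudi_self {n : ℕ} {la : YoungDiagram} (h : la.colLen 0 ≤ n)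
    (x : Fin n → R) : schur la x = jacobiTrudi (completeSeries x) (shifted n la) := by
  have h1 : schurPoly n la = jacobiTrudi (completeSeries X) (shifted n la) := by
    refine mul_left_cancel₀ (delta_X_ne_zero n) ?_
    rw [delta_mul_schurPoly h, alternant_eq_delta_mul_jacobiTrudi]
  rw [schur, h1]
  have h2 := map_jacobiTrudi (aeval (R := ℤ) x).toRingHom (completeSeries X) (shifted n la)
  rw [map_completeSeries] at h2
  simpa using h2

open MvPolynomial in
theorem schur_snoc_zero {n : ℕ} (la : YoungDiagram) (x : Fin n → R) :
    schur la (Fin.snoc (α := fun _ => R) x 0 : Fin (n + 1) → R) = schur la x := by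
  have h : (aeval x).comp (aeval (Fin.snoc (α := fun _ => MvPolynomial (Fin n) ℤ) X 0)) =
      aeval (R := ℤ) (Fin.snoc (α := fun _ => R) x 0 : Fin (n + 1) → R) := by
    refine algHom_ext fun i => ?_
    induction i using Fin.lastCases <;> simp
  rw [schur, schur, ← h, ← killLast_schurPoly n, killLast, AlgHom.comp_apply]

theorem completeSeries_snoc {n : ℕ} (x : Fin n → R) (z : R) :
    completeSeries (Fin.snoc (α := fun _ => R) x z : Fin (n + 1) → R) =
      completeSeries x * geomSeries z := by
  simp [completeSeries, Fin.prod_univ_castSucc]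

theorem geomSeries_zero : geomSeries (0 : R) = 1 := by
  simpa using geomSeries_mul (0 : R)

/-- The Jacobi-Trudi identity. -/
theorem schur_eq_jacobiTrudi {n N : ℕ} (hn : n ≤ N) {la : YoungDiagram} (h : la.colLen 0 ≤ N)
    (x : Fin n → R) : schur la x = jacobiTrudi (completeSeries x) (shifted N la) := by
  obtain ⟨d, hd⟩ := Nat.exists_eq_add_of_le hn
  -- Padding `x` with a zero variable changes neither the Schur function nor the complete series, so
  -- `n` can be raised to `N`.
  induction d generalizing n with
  | zero => obtain rfl : N = n := hd; exact schur_eq_jacobiTrudi_self h x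
  | succ d ih =>
    have h1 := ih (n := n + 1) (by omega) (Fin.snoc (α := fun _ => R) x 0 : Fin (n + 1) → R)
      (by omega)
    rw [schur_snoc_zero, completeSeries_snoc,
      geomSeries_zero, mul_one] at h1
    exact h1

end Basic


/-! ### Littlewood-Richardson coefficients as structure constants for products of series. -/

section Coproduct

open MvPolynomial

variable {R : Type*} [CommRing R]

theorem exists_perm_shifted {N : ℕ} {a : Fin N → ℕ} (ha : Function.Injective a) :
    ∃ (la : YoungDiagram) (s : Equiv.Perm (Fin N)),
      la.colLen 0 ≤ N ∧ shifted N la = a ∘ s := by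
  let s : Equiv.Perm (Fin N) := Fin.revPerm.trans (Tuple.sort a)
  have hs : StrictAnti (a ∘ s) := by
    have hm : StrictMono (a ∘ Tuple.sort a) :=
      (Tuple.monotone_sort a).strictMono_of_injective (ha.comp (Tuple.sort a).injective)
    intro i j hij
    exact hm (Fin.rev_lt_rev.2 hij)
  obtain ⟨la, h1, h2⟩ := exists_shifted hs
  exact ⟨la, s, h1, h2⟩

theorem coeff_prod_aeval_X {N : ℕ} (Q : Fin N → Polynomial R) (a : Fin N → ℕ) :
    coeff (Finsupp.equivFunOnFinite.symm a)
      (∏ i, Polynomial.aeval (X i : MvPolynomial (Fin N) R) (Q i)) = ∏ i, (Q i).coeff (a i) := by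
  classical
  have h1 : ∀ i, Polynomial.aeval (X i : MvPolynomial (Fin N) R) (Q i) =
      ∑ e ∈ (Q i).support, C ((Q i).coeff e) * X i ^ e := by
    intro i
    rw [Polynomial.aeval_def, Polynomial.eval₂_def, Polynomial.sum_def]
    rfl
  have h2 : ∀ e : Fin N → ℕ, (∏ i, C ((Q i).coeff (e i)) * X i ^ e i : MvPolynomial (Fin N) R) =
      monomial (Finsupp.equivFunOnFinite.symm e) (∏ i, (Q i).coeff (e i)) := by
    intro e
    rw [monomial_eq, Finsupp.prod_fintype _ _ (by simp), Finset.prod_mul_distrib, map_prod]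
    simp
  simp only [h1]
  rw [Finset.prod_univ_sum, coeff_sum]
  simp only [h2, coeff_monomial, EmbeddingLike.apply_eq_iff_eq]
  rw [Finset.sum_ite_eq' ]
  split_ifs with h
  · rfl
  · simp only [Fintype.mem_piFinset, not_forall, Polynomial.mem_support_iff, not_not] at h
    obtain ⟨i, hi⟩ := h
    exact (Finset.prod_eq_zero (Finset.mem_univ i) hi).symm

/-- Row `i` involves the variable `X i` alone, so extracting the coefficient of a monomial acts row
by row. -/
theorem coeff_det_aeval_X {N : ℕ} (Q : Fin N → Polynomial R) (a : Fin N → ℕ) :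
    coeff (Finsupp.equivFunOnFinite.symm a)
      (Matrix.det (Matrix.of fun i j : Fin N =>
        Polynomial.aeval (X i : MvPolynomial (Fin N) R) (Q j))) =
      Matrix.det (Matrix.of fun i j => (Q j).coeff (a i)) := by
  rw [← Matrix.det_transpose, Matrix.det_apply', coeff_sum, ← Matrix.det_transpose,
    Matrix.det_apply']
  refine Finset.sum_congr rfl fun s _ => ?_
  simp only [Matrix.transpose_apply, Matrix.of_apply]
  rw [← coeff_prod_aeval_X (fun i => Q (s i)) a, ← map_intCast (C : R →+* MvPolynomial (Fin N) R),
    coeff_C_mul]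

theorem coeff_alternant_X {N : ℕ} (a b : Fin N → ℕ) :
    coeff (Finsupp.equivFunOnFinite.symm a)
      (alternant (X : Fin N → MvPolynomial (Fin N) R) b) =
      Matrix.det (Matrix.of fun i j => (Polynomial.X ^ b j : Polynomial R).coeff (a i)) := by
  rw [← coeff_det_aeval_X]
  simp [alternant]

theorem delta_mul_prod_aeval {N : ℕ} (H : Polynomial R) :
    delta (X : Fin N → MvPolynomial (Fin N) R) * ∏ i, Polynomial.aeval (X i) H =
      Matrix.det (Matrix.of fun i j : Fin N =>
        Polynomial.aeval (X i : MvPolynomial (Fin N) R) (Polynomial.X ^ (N - 1 - (j : ℕ)) * H)) := by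
  rw [delta_eq_alternant, alternant, mul_comm, ← Matrix.det_mul_column]
  congr 1
  ext i j : 2
  simp [mul_comm]

/-- The bridge to generating functions: `Δ(u) ∏ H(u_i)` collects all Jacobi-Trudi determinants of
`H` of size `N`. -/
theorem coeff_delta_mul_prod_aeval {N : ℕ} (H : Polynomial R) (a : Fin N → ℕ) :
    coeff (Finsupp.equivFunOnFinite.symm a)
      (delta (X : Fin N → MvPolynomial (Fin N) R) * ∏ i, Polynomial.aeval (X i) H) =
      jacobiTrudi (H : PowerSeries R) a := by
  rw [delta_mul_prod_aeval, coeff_det_aeval_X, jacobiTrudi]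
  congr 1
  ext i j
  rw [Matrix.of_apply, Matrix.of_apply, ← Polynomial.coeff_coe]
  simp

theorem delta_mul_schur {n : ℕ} {la : YoungDiagram} (h : la.colLen 0 ≤ n) (x : Fin n → R) :
    delta x * schur la x = alternant x (shifted n la) := by
  rw [schur_eq_jacobiTrudi_self h, alternant_eq_delta_mul_jacobiTrudi]

theorem coeff_alternant_shifted {N : ℕ} {la mu : YoungDiagram} (hl : la.colLen 0 ≤ N)
    (hm : mu.colLen 0 ≤ N) [DecidableEq YoungDiagram] :
    coeff (Finsupp.equivFunOnFinite.symm (shifted N la))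
      (alternant (X : Fin N → MvPolynomial (Fin N) R) (shifted N mu)) =
      if mu = la then 1 else 0 := by
  have h1 : alternant (X : Fin N → MvPolynomial (Fin N) R) (shifted N mu) =
      MvPolynomial.map (Int.castRingHom R) (alternant X (shifted N mu)) := by
    rw [alternant, alternant, RingHom.map_det]
    congr 1
    ext i j : 2
    simp
  rw [h1, coeff_map, coeff_alternant _ (shifted_strictAnti N mu) _ (by
    simpa using shifted_strictAnti N la)]
  by_cases h : mu = la
  · simp [h]
  · have : ¬ shifted N la = shifted N mu := fun e => h (shifted_inj hl hm e).symm
    simp [h, this]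

/-- Vanishing at repeated exponents is a separate hypothesis because the sign rule alone gives only
`c = -c` there, which is too weak in a ring where `2` may be a zero divisor. -/
theorem eq_zero_of_alternating_coeff {N : ℕ} {G : MvPolynomial (Fin N) R}
    (h1 : ∀ a : Fin N → ℕ, ¬ Function.Injective a →
      coeff (Finsupp.equivFunOnFinite.symm a) G = 0)
    (h2 : ∀ (a : Fin N → ℕ) (s : Equiv.Perm (Fin N)),
      coeff (Finsupp.equivFunOnFinite.symm (a ∘ s)) G =
        ((Equiv.Perm.sign s : ℤ) : R) * coeff (Finsupp.equivFunOnFinite.symm a) G)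
    (h3 : ∀ la : YoungDiagram, la.colLen 0 ≤ N →
      coeff (Finsupp.equivFunOnFinite.symm (shifted N la)) G = 0) : G = 0 := by
  ext d
  obtain ⟨a, rfl⟩ := Finsupp.equivFunOnFinite.symm.surjective d
  rw [coeff_zero]
  by_cases ha : Function.Injective a
  · obtain ⟨la, s, hl, hs⟩ := exists_perm_shifted ha
    have h4 := h2 a s
    rw [← hs, h3 la hl] at h4
    rcases Int.units_eq_one_or (Equiv.Perm.sign s) with h5 | h5 <;> rw [h5] at h4 <;>
      simpa using h4.symm
  · exact h1 a ha

/-- The Cauchy identity `∏ H(u_i) = ∑_mu S_mu[H] s_mu(u)`, multiplied by `Δ(u)`. -/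
theorem delta_mul_prod_aeval_eq_sum {N : ℕ} (H : Polynomial R) (T : Finset YoungDiagram)
    (hT : ∀ mu : YoungDiagram, mu.colLen 0 ≤ N →
      jacobiTrudi (H : PowerSeries R) (shifted N mu) ≠ 0 → mu ∈ T) :
    delta (X : Fin N → MvPolynomial (Fin N) R) * ∏ i, Polynomial.aeval (X i) H =
      ∑ mu ∈ T with mu.colLen 0 ≤ N,
        C (jacobiTrudi (H : PowerSeries R) (shifted N mu)) * alternant X (shifted N mu) := by
  classical
  rw [← sub_eq_zero]
  apply eq_zero_of_alternating_coeff
  · intro a ha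
    rw [coeff_sub, coeff_delta_mul_prod_aeval, jacobiTrudi_eq_zero _ ha, coeff_sum,
      Finset.sum_eq_zero, sub_zero]
    intro mu _
    rw [coeff_C_mul, coeff_alternant_X]
    simp only [Function.Injective, not_forall] at ha
    obtain ⟨i, j, hij, hne⟩ := ha
    rw [Matrix.det_zero_of_row_eq hne (by ext k; simp [hij]), mul_zero]
  · intro a s
    simp only [coeff_sub, coeff_delta_mul_prod_aeval, jacobiTrudi_comp_perm, coeff_sum, mul_sub,
      Finset.mul_sum, coeff_C_mul]
    congr 1
    refine Finset.sum_congr rfl fun mu _ => ?_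
    rw [coeff_alternant_X, coeff_alternant_X, mul_left_comm, ← Matrix.det_permute]
    rfl
  · intro la hl
    rw [coeff_sub, coeff_delta_mul_prod_aeval, coeff_sum, sub_eq_zero]
    have h : ∀ mu ∈ T.filter (fun mu => mu.colLen 0 ≤ N),
        coeff (Finsupp.equivFunOnFinite.symm (shifted N la))
          (C (jacobiTrudi (H : PowerSeries R) (shifted N mu)) *
            alternant (X : Fin N → MvPolynomial (Fin N) R) (shifted N mu)) =
        if mu = la then jacobiTrudi (H : PowerSeries R) (shifted N mu) else 0 := by
      intro mu hmu
      rw [coeff_C_mul, coeff_alternant_shifted hl (Finset.mem_filter.1 hmu).2]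
      simp
    rw [Finset.sum_congr rfl h, Finset.sum_ite_eq']
    split_ifs with h4
    · rfl
    · by_contra h5
      exact h4 (Finset.mem_filter.2 ⟨hT la hl h5, hl⟩)

/-- These diagrams inject into the support of the polynomial `Δ(u) ∏ H(u_i)`. -/
theorem finite_jacobiTrudi_ne_zero (N : ℕ) (H : Polynomial R) :
    {mu : YoungDiagram | mu.colLen 0 ≤ N ∧
      jacobiTrudi (H : PowerSeries R) (shifted N mu) ≠ 0}.Finite := by
  refine Set.Finite.of_injOn (f := fun mu => Finsupp.equivFunOnFinite.symm (shifted N mu))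
    (t := (delta (X : Fin N → MvPolynomial (Fin N) R) *
      ∏ i, Polynomial.aeval (X i) H).support) ?_ ?_ (Finset.finite_toSet _)
  · rintro mu ⟨-, h⟩
    rw [← coeff_delta_mul_prod_aeval] at h
    simpa using h
  · rintro mu ⟨h, -⟩ nu ⟨h', -⟩ e
    exact shifted_inj h h' (Finsupp.equivFunOnFinite.symm.injective e)

theorem schur_mul_schur (mu nu : YoungDiagram) :
    ∃ T : Finset YoungDiagram, (∀ la, littlewoodRichardson la mu nu ≠ 0 → la ∈ T) ∧
      ∀ {R : Type*} [CommRing R] {n : ℕ} (x : Fin n → R), schur mu x * schur nu x =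
        ∑ la ∈ T, (littlewoodRichardson la mu nu : R) * schur la x := by
  refine ⟨(Classical.choose (existsUnique_littlewoodRichardson mu nu).exists).support,
    fun la h => Finsupp.mem_support_iff.2 h, fun {R} _ {n} x => ?_⟩
  have h := congrArg (aeval x) (Classical.choose_spec
    (existsUnique_littlewoodRichardson mu nu).exists n)
  rw [map_mul] at h
  rw [schur, schur, h, Finsupp.sum, map_sum]
  refine Finset.sum_congr rfl fun la _ => ?_
  rw [map_zsmul, zsmul_eq_mul]
  rfl

/-- Multiplication by `Δ` turns each Schur function of length at most `N` in the product expansion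
into an alternant, and only the one of `la` has a nonzero coefficient at `la + ρ`. -/
theorem coeff_delta_mul_schur_mul_schur {N : ℕ} (la mu nu : YoungDiagram)
    (hl : la.colLen 0 ≤ N) :
    coeff (Finsupp.equivFunOnFinite.symm (shifted N la))
      (delta (X : Fin N → MvPolynomial (Fin N) R) * (schur mu (X : Fin N → MvPolynomial (Fin N) R) *
        schur nu (X : Fin N → MvPolynomial (Fin N) R))) =
      (littlewoodRichardson la mu nu : R) := by
  classical
  obtain ⟨T, hT, h⟩ := schur_mul_schur mu nu
  rw [h, Finset.mul_sum, coeff_sum]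
  have h2 : ∀ ka, coeff (Finsupp.equivFunOnFinite.symm (shifted N la))
      (delta (X : Fin N → MvPolynomial (Fin N) R) *
        ((littlewoodRichardson ka mu nu : MvPolynomial (Fin N) R) *
          schur ka (X : Fin N → MvPolynomial (Fin N) R))) =
      if ka = la then (littlewoodRichardson ka mu nu : R) else 0 := by
    intro ka
    by_cases hk : ka.colLen 0 ≤ N
    · rw [mul_left_comm, delta_mul_schur hk, ← map_intCast (C : R →+* MvPolynomial (Fin N) R),
        coeff_C_mul, coeff_alternant_shifted hl hk]
      simp
    · rw [schur, schurPoly, if_neg hk, if_neg]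
      · simp
      · rintro rfl
        exact hk hl
  simp only [h2]
  rw [Finset.sum_ite_eq']
  split_ifs with h4
  · rfl
  · have : littlewoodRichardson la mu nu = 0 := by
      by_contra h5
      exact h4 (hT la h5)
    simp [this]

/-- Expand `∏ H(u_i)` and `∏ G(u_i)` separately by the Cauchy identity and compare the coefficients
at `la + ρ` in `Δ(u) ∏ (H G)(u_i)`. Polynomials make both expansions finite, and `la.card ≤ N`
guarantees that no pair with a nonzero coefficient is too long for `N` variables. -/
theorem jacobiTrudi_coe_mul {N : ℕ} (H G : Polynomial R) (la : YoungDiagram) (hl : la.card ≤ N) :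
    jacobiTrudi ((H : PowerSeries R) * (G : PowerSeries R)) (shifted N la) =
      ∑ᶠ p : YoungDiagram × YoungDiagram, (littlewoodRichardson la p.1 p.2 : R) *
        jacobiTrudi (H : PowerSeries R) (shifted N p.1) *
        jacobiTrudi (G : PowerSeries R) (shifted N p.2) := by
  classical
  let T := (finite_jacobiTrudi_ne_zero N H).toFinset
  let U := (finite_jacobiTrudi_ne_zero N G).toFinset
  have hT : T.filter (fun mu => mu.colLen 0 ≤ N) = T :=
    Finset.filter_true_of_mem fun mu h => ((Set.Finite.mem_toFinset _).1 h).1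
  have hU : U.filter (fun mu => mu.colLen 0 ≤ N) = U :=
    Finset.filter_true_of_mem fun mu h => ((Set.Finite.mem_toFinset _).1 h).1
  have e1 := delta_mul_prod_aeval_eq_sum (N := N) H T fun mu h1 h2 =>
    (Set.Finite.mem_toFinset _).2 ⟨h1, h2⟩
  have e2 := delta_mul_prod_aeval_eq_sum (N := N) G U fun mu h1 h2 =>
    (Set.Finite.mem_toFinset _).2 ⟨h1, h2⟩
  rw [hT] at e1
  rw [hU] at e2
  have e3 : delta (X : Fin N → MvPolynomial (Fin N) R) * ∏ i, Polynomial.aeval (X i) (H * G) =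
      ∑ p ∈ T ×ˢ U, C (jacobiTrudi (H : PowerSeries R) (shifted N p.1) *
        jacobiTrudi (G : PowerSeries R) (shifted N p.2)) *
        (delta X * (schur p.1 X * schur p.2 X)) := by
    simp only [map_mul, Finset.prod_mul_distrib]
    rw [← mul_assoc, e1, Finset.sum_product, Finset.sum_mul]
    refine Finset.sum_congr rfl fun mu hmu => ?_
    rw [← delta_mul_schur ((Set.Finite.mem_toFinset _).1 hmu).1]
    trans C (jacobiTrudi (H : PowerSeries R) (shifted N mu)) * schur mu X *
      (delta (X : Fin N → MvPolynomial (Fin N) R) * ∏ i, Polynomial.aeval (X i) G)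
    · ring
    rw [e2, Finset.mul_sum]
    refine Finset.sum_congr rfl fun nu hnu => ?_
    rw [← delta_mul_schur ((Set.Finite.mem_toFinset _).1 hnu).1]
    ring
  have e4 := congrArg (coeff (Finsupp.equivFunOnFinite.symm (shifted N la))) e3
  rw [coeff_delta_mul_prod_aeval, coeff_sum, Polynomial.coe_mul] at e4
  rw [e4, finsum_eq_sum_of_support_subset (s := T ×ˢ U)]
  · refine Finset.sum_congr rfl fun p _ => ?_
    rw [coeff_C_mul, coeff_delta_mul_schur_mul_schur _ _ _ ((colLen_le_card la).trans hl)]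
    ring
  · intro p hp
    rw [Function.mem_support] at hp
    have h1 : littlewoodRichardson la p.1 p.2 ≠ 0 := fun h => hp (by simp [h])
    have h2 := card_eq_of_littlewoodRichardson_ne_zero h1
    have h3 := colLen_le_card p.1
    have h4 := colLen_le_card p.2
    rw [Finset.mem_coe, Finset.mem_product]
    exact ⟨(Set.Finite.mem_toFinset _).2 ⟨by omega, fun h => hp (by simp [h])⟩,
      (Set.Finite.mem_toFinset _).2 ⟨by omega, fun h => hp (by simp [h])⟩⟩

theorem jacobiTrudi_congr {N M : ℕ} {H G : PowerSeries R}
    (h : ∀ k < M, PowerSeries.coeff k H = PowerSeries.coeff k G) {a : Fin N → ℕ}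
    (ha : ∀ i, a i < M) : jacobiTrudi H a = jacobiTrudi G a := by
  rw [jacobiTrudi, jacobiTrudi]
  congr 1
  ext i j
  rw [Matrix.of_apply, Matrix.of_apply, PowerSeries.coeff_X_pow_mul',
    PowerSeries.coeff_X_pow_mul', h _ (by have := ha i; omega)]

theorem rowLen_le_card (la : YoungDiagram) (j : ℕ) : la.rowLen j ≤ la.card := by
  rw [YoungDiagram.rowLen_eq_card]; exact Finset.card_le_card (Finset.filter_subset _ _)

/-- The coproduct of Schur functions has the Littlewood-Richardson coefficients as structure
constants. -/
theorem jacobiTrudi_mul {N : ℕ} (H G : PowerSeries R) (la : YoungDiagram) (hl : la.card ≤ N) :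
    jacobiTrudi (H * G) (shifted N la) =
      ∑ᶠ p : YoungDiagram × YoungDiagram, (littlewoodRichardson la p.1 p.2 : R) *
        jacobiTrudi H (shifted N p.1) * jacobiTrudi G (shifted N p.2) := by
  -- `M` exceeds every exponent `mu_i + N - 1 - i` with `mu.card ≤ la.card`, so all the determinants
  -- involved see only the truncations of `H` and `G` at `M`.
  let M := la.card + N
  have ht : ∀ (H : PowerSeries R), ∀ k < M,
      PowerSeries.coeff k H = PowerSeries.coeff k (PowerSeries.trunc M H : PowerSeries R) := by
    intro H k hk
    rw [Polynomial.coeff_coe, PowerSeries.coeff_trunc, if_pos hk]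
  have hs : ∀ mu : YoungDiagram, mu.card ≤ la.card → ∀ i : Fin N, shifted N mu i < M := by
    intro mu hmu i
    have := rowLen_le_card mu i
    have := i.2
    simp only [shifted, M]
    omega
  have h1 := jacobiTrudi_coe_mul (PowerSeries.trunc M H) (PowerSeries.trunc M G) la hl
  rw [jacobiTrudi_congr (H := H * G)
    (G := (PowerSeries.trunc M H : PowerSeries R) * (PowerSeries.trunc M G : PowerSeries R))
    (M := M) ?_ (hs la le_rfl), h1]
  · refine finsum_congr fun p => ?_
    by_cases h0 : littlewoodRichardson la p.1 p.2 = 0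
    · simp [h0]
    have h2 := card_eq_of_littlewoodRichardson_ne_zero h0
    rw [jacobiTrudi_congr (ht H) (hs p.1 (by omega)), jacobiTrudi_congr (ht G) (hs p.2 (by omega))]
  · intro k hk
    rw [PowerSeries.coeff_mul, PowerSeries.coeff_mul]
    refine Finset.sum_congr rfl fun p hp => ?_
    have := Finset.HasAntidiagonal.mem_antidiagonal.1 hp
    rw [← ht H p.1 (by omega), ← ht G p.2 (by omega)]

end Coproduct


/-! ### Strips, the dual Jacobi-Trudi identity and the determinant for Littlewood-Schur functions.
-/

/-- `ka` arises from `la` by removing a vertical strip. -/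
def VerticalStrip (la ka : YoungDiagram) : Prop :=
  ∀ i, ka.rowLen i ≤ la.rowLen i ∧ la.rowLen i ≤ ka.rowLen i + 1

/-- `ka` arises from `la` by removing a horizontal strip. -/
def HorizontalStrip (la ka : YoungDiagram) : Prop :=
  ∀ i, ka.rowLen i ≤ la.rowLen i ∧ la.rowLen (i + 1) ≤ ka.rowLen i

theorem rowLen_le_iff {la : YoungDiagram} {i j : ℕ} : la.rowLen i ≤ j ↔ la.colLen j ≤ i := by
  rw [← not_lt, ← not_lt, ← YoungDiagram.mem_iff_lt_rowLen, ← YoungDiagram.mem_iff_lt_colLen]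

theorem le_of_rowLen_le {la ka : YoungDiagram} (h : ∀ i, ka.rowLen i ≤ la.rowLen i) : ka ≤ la := by
  rintro ⟨i, j⟩ hij
  exact YoungDiagram.mem_iff_lt_rowLen.2
    ((YoungDiagram.mem_iff_lt_rowLen.1 hij).trans_le (h i))

theorem rowLen_le_of_le {la ka : YoungDiagram} (h : ka ≤ la) (i : ℕ) :
    ka.rowLen i ≤ la.rowLen i := by
  by_contra! h1
  have := h (YoungDiagram.mem_iff_lt_rowLen.2 h1 : (i, la.rowLen i) ∈ ka)
  exact lt_irrefl _ (YoungDiagram.mem_iff_lt_rowLen.1 this)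

theorem colLen_le_of_le {la ka : YoungDiagram} (h : ka ≤ la) (j : ℕ) :
    ka.colLen j ≤ la.colLen j :=
  rowLen_le_iff.1 ((rowLen_le_of_le h _).trans (rowLen_le_iff.2 le_rfl))

theorem card_le_of_le {la ka : YoungDiagram} (h : ka ≤ la) : ka.card ≤ la.card :=
  Finset.card_le_card h

theorem verticalStrip_iff {la ka : YoungDiagram} :
    VerticalStrip la ka ↔ HorizontalStrip la.transpose ka.transpose := by
  have hH : HorizontalStrip la.transpose ka.transpose ↔
      ∀ j, ka.colLen j ≤ la.colLen j ∧ la.colLen (j + 1) ≤ ka.colLen j := by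
    simp only [HorizontalStrip, YoungDiagram.rowLen_transpose]
  rw [hH]
  constructor
  · intro h j
    refine ⟨colLen_le_of_le (le_of_rowLen_le fun i => (h i).1) j, ?_⟩
    rw [← rowLen_le_iff]
    exact (h _).2.trans (Nat.succ_le_succ (rowLen_le_iff.2 le_rfl))
  · intro h i
    refine ⟨rowLen_le_iff.2 ((h _).1.trans (rowLen_le_iff.1 le_rfl)), ?_⟩
    rw [rowLen_le_iff]
    exact (h _).2.trans (rowLen_le_iff.1 le_rfl)

theorem finite_le (la : YoungDiagram) : {ka : YoungDiagram | ka ≤ la}.Finite := by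
  refine (Set.Finite.biUnion (Finset.finite_toSet (Finset.range (la.card + 1)))
    fun d _ => finite_card_eq d).subset fun ka h => ?_
  have := card_le_of_le (ka := ka) (la := la) h
  simp only [Set.mem_iUnion]
  exact ⟨ka.card, by simpa using Nat.lt_succ_of_le this, rfl⟩

/-- The diagrams that arise from `la` by removing a vertical strip. -/
noncomputable def verticalStrips (la : YoungDiagram) : Finset YoungDiagram :=
  ((finite_le la).subset fun ka (h : VerticalStrip la ka) =>
    le_of_rowLen_le fun i => (h i).1).toFinset

/-- The diagrams that arise from `la` by removing a horizontal strip. -/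
noncomputable def horizontalStrips (la : YoungDiagram) : Finset YoungDiagram :=
  ((finite_le la).subset fun ka (h : HorizontalStrip la ka) =>
    le_of_rowLen_le fun i => (h i).1).toFinset

theorem mem_verticalStrips {la ka : YoungDiagram} :
    ka ∈ verticalStrips la ↔ VerticalStrip la ka :=
  Set.Finite.mem_toFinset _

theorem mem_horizontalStrips {la ka : YoungDiagram} :
    ka ∈ horizontalStrips la ↔ HorizontalStrip la ka :=
  Set.Finite.mem_toFinset _

section Strips

variable {R : Type*} [CommRing R]

/-- Multilinearity in the rows: one exponent is chosen from each `A i`, and the powers of `y`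
collect. -/
theorem det_rows_eq_sum {N : ℕ} (H : PowerSeries R) (y : R) (a : Fin N → ℕ)
    (A : Fin N → Finset ℕ) (hA : ∀ i, ∀ b ∈ A i, b ≤ a i) :
    Matrix.det (Matrix.of fun i j : Fin N => ∑ b ∈ A i, y ^ (a i - b) *
      PowerSeries.coeff b (PowerSeries.X ^ (N - 1 - (j : ℕ)) * H)) =
    ∑ r ∈ Fintype.piFinset A, y ^ (∑ i, a i - ∑ i, r i) * jacobiTrudi H r := by
  have h1 := (Matrix.detRowAlternating (n := Fin N) (R := R)).toMultilinearMap.map_sum_finset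
    (fun i b => y ^ (a i - b) • fun j : Fin N =>
      PowerSeries.coeff b (PowerSeries.X ^ (N - 1 - (j : ℕ)) * H)) A
  have h2 : (fun i : Fin N => ∑ b ∈ A i, y ^ (a i - b) • fun j : Fin N =>
      PowerSeries.coeff b (PowerSeries.X ^ (N - 1 - (j : ℕ)) * H)) =
      Matrix.of fun i j : Fin N => ∑ b ∈ A i, y ^ (a i - b) *
      PowerSeries.coeff b (PowerSeries.X ^ (N - 1 - (j : ℕ)) * H) := by
    ext i j
    simp
  rw [h2] at h1
  refine h1.trans (Finset.sum_congr rfl fun r hr => ?_)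
  rw [MultilinearMap.map_smul_univ, smul_eq_mul, Finset.prod_pow_eq_pow_sum,
    Finset.sum_tsub_distrib _ fun i _ => hA i _ (Fintype.mem_piFinset.1 hr i)]
  rfl

/-- Strictly decreasing choices of exponents are exactly the sequences `ka + ρ`, so a sum over
choices becomes a sum over partitions. -/
theorem sum_piFinset_eq {N : ℕ} (g : (Fin N → ℕ) → R) (A : Fin N → Finset ℕ)
    (T : Finset YoungDiagram) (hT : ∀ ka ∈ T, ka.colLen 0 ≤ N)
    (hT' : ∀ ka : YoungDiagram, ka.colLen 0 ≤ N → (ka ∈ T ↔ ∀ i, shifted N ka i ∈ A i))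
    (hg : ∀ r ∈ Fintype.piFinset A, ¬ StrictAnti r → g r = 0) :
    ∑ r ∈ Fintype.piFinset A, g r = ∑ ka ∈ T, g (shifted N ka) := by
  symm
  refine Finset.sum_of_injOn (shifted N) (fun ka h ka' h' e => shifted_inj (hT _ h) (hT _ h') e)
    (fun ka h => ?_) (fun r hr hr' => ?_) fun ka _ => rfl
  · exact Fintype.mem_piFinset.2 ((hT' ka (hT ka h)).1 h)
  · refine hg r hr fun hs => hr' ?_
    obtain ⟨ka, hk, rfl⟩ := exists_shifted hs
    exact ⟨ka, (hT' ka hk).2 (Fintype.mem_piFinset.1 hr), rfl⟩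

theorem sum_shifted_sub {N : ℕ} {la ka : YoungDiagram} (hl : la.colLen 0 ≤ N)
    (hk : ka.colLen 0 ≤ N) :
    ∑ i, shifted N la i - ∑ i, shifted N ka i = la.card - ka.card := by
  rw [sum_shifted hl, sum_shifted hk]
  omega

/-- Multiplication by `1 + y t` adds to the row of exponent `a` the row of exponent `a - 1` times
`y`. Lowering some exponents of `la + ρ` by one either leaves them strictly decreasing, which
removes a vertical strip, or creates two equal rows. -/
theorem jacobiTrudi_mul_one_add {N : ℕ} (H : PowerSeries R) (y : R) {la : YoungDiagram}
    (hl : la.colLen 0 ≤ N) :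
    jacobiTrudi (H * (1 + PowerSeries.C y * PowerSeries.X)) (shifted N la) =
      ∑ ka ∈ verticalStrips la, y ^ (la.card - ka.card) * jacobiTrudi H (shifted N ka) := by
  -- For exponent `0` truncated subtraction leaves only `{0}`, as it should: there is no coefficient
  -- of `t^(-1)`.
  let A : Fin N → Finset ℕ := fun i => Finset.Icc (shifted N la i - 1) (shifted N la i)
  have h1 : jacobiTrudi (H * (1 + PowerSeries.C y * PowerSeries.X)) (shifted N la) =
      Matrix.det (Matrix.of fun i j : Fin N => ∑ b ∈ A i, y ^ (shifted N la i - b) *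
        PowerSeries.coeff b (PowerSeries.X ^ (N - 1 - (j : ℕ)) * H)) := by
    rw [jacobiTrudi]
    congr 1
    ext i j
    rw [Matrix.of_apply, Matrix.of_apply, ← mul_assoc]
    simp only [A]
    generalize PowerSeries.X ^ (N - 1 - (j : ℕ)) * H = P
    rw [mul_add, mul_one, mul_left_comm, map_add, PowerSeries.coeff_C_mul]
    cases shifted N la i with
    | zero => simp
    | succ a =>
      rw [PowerSeries.coeff_succ_mul_X, Nat.add_sub_cancel, ← Finset.insert_Icc_add_one_left_eq_Icc
        (Nat.le_succ a), Nat.succ_eq_add_one, Finset.Icc_self, Finset.sum_insert (by simp),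
        Finset.sum_singleton]
      simp [add_comm]
  have hle : ∀ ka ∈ verticalStrips la, ka.colLen 0 ≤ N := fun ka h =>
    (colLen_le_of_le (le_of_rowLen_le fun i => (mem_verticalStrips.1 h i).1) 0).trans hl
  rw [h1, det_rows_eq_sum _ _ _ _ fun i b hb => (Finset.mem_Icc.1 hb).2,
    sum_piFinset_eq _ _ (verticalStrips la) hle]
  · exact Finset.sum_congr rfl fun ka h => by rw [sum_shifted_sub hl (hle ka h)]
  · intro ka hk
    rw [mem_verticalStrips]
    simp only [Finset.mem_Icc, shifted]
    constructor
    · intro h i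
      have := h i
      omega
    · intro h i
      by_cases hi : i < N
      · have := h ⟨i, hi⟩
        simp only at this
        omega
      · rw [rowLen_eq_zero (hl.trans (not_lt.1 hi)), rowLen_eq_zero (hk.trans (not_lt.1 hi))]
        omega
  · intro r hr hs
    rw [jacobiTrudi_eq_zero, mul_zero]
    intro hinj
    refine hs fun i j hij => lt_of_le_of_ne ?_ (hinj.ne hij.ne')
    have h2 := Finset.mem_Icc.1 (Fintype.mem_piFinset.1 hr i)
    have h3 := Finset.mem_Icc.1 (Fintype.mem_piFinset.1 hr j)
    have := shifted_strictAnti N la hij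
    omega

/-- The coefficient of `P / (1 - y t)` at `a` is a sum over all `b ≤ a`; subtracting the multiple of
the one at `c` removes the terms with `b ≤ c`. -/
theorem sum_Icc_coeff (P : PowerSeries R) (y : R) {a c : ℕ} (hc : c < a) :
    ∑ b ∈ Finset.Icc (c + 1) a, y ^ (a - b) * PowerSeries.coeff b P =
      PowerSeries.coeff a (P * geomSeries y) -
        y ^ (a - c) * PowerSeries.coeff c (P * geomSeries y) := by
  have h : ∀ d, PowerSeries.coeff d (P * geomSeries y) =
      ∑ b ∈ Finset.range (d + 1), y ^ (d - b) * PowerSeries.coeff b P := by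
    intro d
    rw [PowerSeries.coeff_mul, Finset.Nat.sum_antidiagonal_eq_sum_range_succ_mk]
    exact Finset.sum_congr rfl fun b _ => by rw [geomSeries, PowerSeries.coeff_mk, mul_comm]
  rw [h, h, eq_sub_iff_add_eq', Finset.mul_sum,
    ← Finset.sum_range_add_sum_Ico _ (Nat.succ_le_succ hc.le)]
  congr 1
  · refine Finset.sum_congr rfl fun b hb => ?_
    have := Finset.mem_range.1 hb
    rw [← mul_assoc, ← pow_add]
    congr 2
    omega

/-- Subtracting from each row a multiple of the next, by the unitriangular `U`, confines the new
exponent of row `i` to the interval above the old exponent of row `i + 1`. These intervals are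
disjoint and descending, so every choice is strictly decreasing, and the choices are the horizontal
strips. -/
theorem jacobiTrudi_mul_geomSeries {N : ℕ} (H : PowerSeries R) (y : R) {la : YoungDiagram}
    (hl : la.colLen 0 ≤ N) :
    jacobiTrudi (H * geomSeries y) (shifted N la) =
      ∑ ka ∈ horizontalStrips la, y ^ (la.card - ka.card) * jacobiTrudi H (shifted N ka) := by
  -- The lower end is one more than the next entry of `la + ρ`; in the last row it is `0`, there
  -- being no row to subtract.
  let A : Fin N → Finset ℕ := fun i =>
    Finset.Icc (la.rowLen (i + 1) + (N - 1 - i)) (shifted N la i)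
  have h1 : jacobiTrudi (H * geomSeries y) (shifted N la) =
      Matrix.det (Matrix.of fun i j : Fin N => ∑ b ∈ A i, y ^ (shifted N la i - b) *
        PowerSeries.coeff b (PowerSeries.X ^ (N - 1 - (j : ℕ)) * H)) := by
    let U : Matrix (Fin N) (Fin N) R := Matrix.of fun i j =>
      if i = j then 1 else if (j : ℕ) = i + 1 then - y ^ (shifted N la i - shifted N la j) else 0
    have hU : U.det = 1 := by
      rw [Matrix.det_of_isUpperTriangular]
      · exact Finset.prod_eq_one fun i _ => by simp [U]
      · intro i j hij
        have : (j : ℕ) < i := hij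
        simp only [U, Matrix.of_apply]
        rw [if_neg (by rintro rfl; omega), if_neg (by omega)]
    rw [jacobiTrudi, ← one_mul (Matrix.det _), ← hU, ← Matrix.det_mul]
    congr 1
    ext i j
    rw [Matrix.mul_apply, Matrix.of_apply]
    simp only [A, U, Matrix.of_apply, ← mul_assoc]
    generalize PowerSeries.X ^ (N - 1 - (j : ℕ)) * H = P
    by_cases hi : (i : ℕ) + 1 < N
    · have e : la.rowLen (i + 1) + (N - 1 - i) = shifted N la ⟨i + 1, hi⟩ + 1 := by
        simp only [shifted]; omega
      rw [e, sum_Icc_coeff _ _ (shifted_strictAnti N la (by simp [Fin.lt_def])),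
        Finset.sum_eq_add i ⟨i + 1, hi⟩]
      · simp [Fin.ext_iff, sub_eq_add_neg]
      · simp [Fin.ext_iff]
      · rintro k - ⟨h2, h3⟩
        rw [if_neg h2.symm, if_neg, zero_mul]
        intro h4
        exact h3 (Fin.ext h4)
      · simp
      · simp
    · have e : la.rowLen (i + 1) + (N - 1 - i) = 0 := by
        rw [rowLen_eq_zero (by omega)]; omega
      rw [e, Finset.sum_eq_single i]
      · rw [if_pos rfl, one_mul, PowerSeries.coeff_mul,
          Finset.Nat.sum_antidiagonal_eq_sum_range_succ_mk, Finset.range_eq_Ico]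
        exact Finset.sum_congr rfl fun b _ => by rw [geomSeries, PowerSeries.coeff_mk, mul_comm]
      · intro k _ h2
        rw [if_neg h2.symm, if_neg (by omega), zero_mul]
      · simp
  have hle : ∀ ka ∈ horizontalStrips la, ka.colLen 0 ≤ N := fun ka h =>
    (colLen_le_of_le (le_of_rowLen_le fun i => (mem_horizontalStrips.1 h i).1) 0).trans hl
  rw [h1, det_rows_eq_sum _ _ _ _ fun i b hb => (Finset.mem_Icc.1 hb).2,
    sum_piFinset_eq _ _ (horizontalStrips la) hle]
  · exact Finset.sum_congr rfl fun ka h => by rw [sum_shifted_sub hl (hle ka h)]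
  · intro ka hk
    rw [mem_horizontalStrips]
    simp only [Finset.mem_Icc, shifted]
    constructor
    · intro h i
      have := h i
      omega
    · intro h i
      by_cases hi : i < N
      · have := h ⟨i, hi⟩
        simp only at this
        omega
      · rw [rowLen_eq_zero (hl.trans (not_lt.1 hi)), rowLen_eq_zero (hk.trans (not_lt.1 hi)),
          rowLen_eq_zero (hl.trans ((not_lt.1 hi).trans (Nat.le_succ i)))]
        omega
  · intro r hr hs
    exfalso
    refine hs fun i j hij => ?_
    have h2 := Finset.mem_Icc.1 (Fintype.mem_piFinset.1 hr i)
    have h3 := Finset.mem_Icc.1 (Fintype.mem_piFinset.1 hr j)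
    have h4 : (i : ℕ) < j := hij
    have := la.rowLen_anti (i + 1) j h4
    simp only [shifted] at h2 h3
    omega

/-- The branching rule of Schur functions. -/
theorem schur_succ {n : ℕ} (la : YoungDiagram) (x : Fin (n + 1) → R) :
    schur la x = ∑ ka ∈ horizontalStrips la,
      x (Fin.last n) ^ (la.card - ka.card) * schur ka fun i : Fin n => x i.castSucc := by
  let N := n + 1 + la.colLen 0
  rw [schur_eq_jacobiTrudi (N := N) (by omega) (by omega), completeSeries,
    Fin.prod_univ_castSucc, jacobiTrudi_mul_geomSeries _ _ (by omega)]
  refine Finset.sum_congr rfl fun ka h => ?_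
  have := colLen_le_of_le (le_of_rowLen_le fun i => (mem_horizontalStrips.1 h i).1) 0
  rw [schur_eq_jacobiTrudi (N := N) (by omega) (by omega)]
  rfl

theorem schur_zero (la : YoungDiagram) (x : Fin 0 → R) :
    schur la x = if la.colLen 0 = 0 then 1 else 0 := by
  split_ifs with h
  · rw [schur_eq_jacobiTrudi_self h.le, jacobiTrudi, Matrix.det_isEmpty]
  · rw [schur, schurPoly, if_neg (by omega), map_zero]

/-- The dual Jacobi-Trudi identity. -/
theorem schur_transpose_eq_jacobiTrudi {m N : ℕ} {la : YoungDiagram} (hl : la.colLen 0 ≤ N)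
    (y : Fin m → R) :
    schur la.transpose y = jacobiTrudi (elementarySeries y) (shifted N la) := by
  induction m generalizing la with
  | zero =>
    have h1 := schur_eq_jacobiTrudi (Nat.zero_le N) hl y
    have h2 : completeSeries y = elementarySeries y := by
      simp [completeSeries, elementarySeries]
    rw [← h2, ← h1, schur_zero, schur_zero]
    have h3 : la.transpose.colLen 0 = 0 ↔ la.colLen 0 = 0 := by
      rw [YoungDiagram.colLen_transpose, ← Nat.le_zero, rowLen_le_iff, Nat.le_zero]
    simp only [h3]
  | succ m ih =>
    -- Splitting off the last variable removes a horizontal strip from `la.transpose` on the left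
    -- and a vertical strip from `la` on the right; conjugation matches the two.
    rw [schur_succ, elementarySeries, Fin.prod_univ_castSucc, jacobiTrudi_mul_one_add _ _ hl]
    symm
    refine Finset.sum_nbij' YoungDiagram.transpose YoungDiagram.transpose ?_ ?_ ?_ ?_ ?_
    · intro ka h
      exact mem_horizontalStrips.2 (verticalStrip_iff.1 (mem_verticalStrips.1 h))
    · intro ka h
      refine mem_verticalStrips.2 (verticalStrip_iff.2 ?_)
      rw [YoungDiagram.transpose_transpose]
      exact mem_horizontalStrips.1 h
    · intro ka _; exact YoungDiagram.transpose_transpose ka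
    · intro ka _; exact YoungDiagram.transpose_transpose ka
    · intro ka h
      have := colLen_le_of_le (le_of_rowLen_le fun i => (mem_verticalStrips.1 h i).1) 0
      have hc : ∀ mu : YoungDiagram, mu.transpose.card = mu.card := fun mu => by
        simp [YoungDiagram.card, YoungDiagram.transpose]
      rw [ih (this.trans hl), hc, hc]
      rfl

/-- The Jacobi-Trudi identity for Littlewood-Schur functions. -/
theorem littlewoodSchur_eq_jacobiTrudi {n m N : ℕ} {la : YoungDiagram} (hl : la.colLen 0 ≤ N)
    (x : Fin n → R) (y : Fin m → R) :
    littlewoodSchur la x y =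
      jacobiTrudi (completeSeries x * elementarySeries y) (shifted N la) := by
  have hH : PowerSeries.constantCoeff (completeSeries x * elementarySeries y) = 1 := by
    rw [map_mul, constantCoeff_completeSeries, constantCoeff_elementarySeries, mul_one]
  -- This size is large enough for the product formula and for both Jacobi-Trudi identities at every
  -- pair that contributes; stability leads back to `N`.
  let M := N + n + la.card
  rw [← jacobiTrudi_stable hH hl (show N ≤ M by omega), jacobiTrudi_mul _ _ _ (by omega),
    littlewoodSchur]
  refine finsum_congr fun p => ?_
  by_cases h0 : littlewoodRichardson la p.1 p.2 = 0
  · simp [h0]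
  have h2 := card_eq_of_littlewoodRichardson_ne_zero h0
  have h3 := colLen_le_card p.1
  have h4 := colLen_le_card p.2
  rw [schur_eq_jacobiTrudi (N := M) (by omega) (by omega),
    schur_transpose_eq_jacobiTrudi (N := M) (by omega)]

end Strips


/-! ### Cauchy-Binet and the evaluation of a single Laplace term. -/

section Laplace

variable {R : Type*} [CommRing R]

/-- The Cauchy-Binet formula for an alternating map. The summand `g` is a function on all finite
sets so that the proof of `K.card = l`, required by `orderEmbOfFin`, does not enter the sum. -/
theorem alternatingMap_sum_smul {ι M P : Type*} [Fintype ι] [LinearOrder ι] [AddCommGroup M]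
    [Module R M] [AddCommGroup P] [Module R P] {l : ℕ} (f : M [⋀^Fin l]→ₗ[R] P)
    (B : Fin l → ι → R) (v : ι → M) (g : Finset ι → P)
    (hg : ∀ (K : Finset ι) (h : K.card = l), g K =
      Matrix.det (Matrix.of fun i j => B i (K.orderEmbOfFin h j)) •
        f fun i => v (K.orderEmbOfFin h i)) :
    f (fun i => ∑ p, B i p • v p) = ∑ K ∈ Finset.powersetCard l Finset.univ, g K := by
  classical
  have h1 : f (fun i => ∑ p, B i p • v p) =
      ∑ r : Fin l → ι, (∏ i, B i (r i)) • f fun i => v (r i) := by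
    refine (f.toMultilinearMap.map_sum fun i p => B i p • v p).trans ?_
    exact Finset.sum_congr rfl fun r _ => f.toMultilinearMap.map_smul_univ _ _
  have h2 : ∑ r : Fin l → ι, (∏ i, B i (r i)) • f (fun i => v (r i)) =
      ∑ r : Fin l → ι with Function.Injective r, (∏ i, B i (r i)) • f fun i => v (r i) := by
    symm
    refine Finset.sum_filter_of_ne fun r _ hr => ?_
    by_contra hinj
    simp only [Function.Injective, not_forall] at hinj
    obtain ⟨i, j, hij, hne⟩ := hinj
    exact hr (by rw [f.map_eq_zero_of_eq _ (by rw [hij]) hne, smul_zero])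
  -- Injective choices are grouped by their image `K`; those with image `K` are the permutations of
  -- its increasing enumeration, and their signs assemble the determinant.
  rw [h1, h2, ← Finset.sum_fiberwise_of_maps_to (g := fun r => Finset.univ.image r)
    (t := Finset.powersetCard l Finset.univ)]
  · refine Finset.sum_congr rfl fun K hK => ?_
    have hc := (Finset.mem_powersetCard.1 hK).2
    rw [hg K hc, ← Matrix.det_transpose, Matrix.det_apply, Finset.sum_smul]
    symm
    refine Finset.sum_bij (fun s _ i => K.orderEmbOfFin hc (s i)) ?_ ?_ ?_ ?_
    · intro s _
      have hi : Function.Injective fun i => K.orderEmbOfFin hc (s i) :=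
        (K.orderEmbOfFin hc).injective.comp s.injective
      simp only [Finset.mem_filter, Finset.mem_univ, true_and]
      refine ⟨hi, ?_⟩
      refine Finset.eq_of_subset_of_card_le ?_ ?_
      · intro p hp
        obtain ⟨i, -, rfl⟩ := Finset.mem_image.1 hp
        exact Finset.orderEmbOfFin_mem _ _ _
      · rw [Finset.card_image_of_injective _ hi, Finset.card_univ, Fintype.card_fin, hc]
    · intro s _ t _ h
      ext i : 1
      exact (K.orderEmbOfFin hc).injective (congrFun h i)
    · intro r hr
      simp only [Finset.mem_filter, Finset.mem_univ, true_and] at hr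
      have h3 : ∀ i, ∃ j, K.orderEmbOfFin hc j = r i := by
        intro i
        have h4 : r i ∈ K := by
          rw [← hr.2]; exact Finset.mem_image_of_mem _ (Finset.mem_univ i)
        rwa [← Finset.mem_coe, ← Finset.range_orderEmbOfFin K hc] at h4
      choose s hs using h3
      have hinj : Function.Injective s := by
        intro i j hij
        apply hr.1
        rw [← hs, ← hs, hij]
      exact ⟨Equiv.ofBijective s (Finite.injective_iff_bijective.1 hinj), Finset.mem_univ _,
        funext hs⟩
    · intro s _
      have h3 := f.map_perm (fun i => v (K.orderEmbOfFin hc i)) s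
      have h4 : f (fun i => v (K.orderEmbOfFin hc (s i))) =
        Equiv.Perm.sign s • f fun i => v (K.orderEmbOfFin hc i) := h3
      rw [h4]
      simp only [Matrix.transpose_apply, Matrix.of_apply]
      rw [smul_comm, smul_assoc]
  · intro r hr
    simp only [Finset.mem_filter, Finset.mem_univ, true_and] at hr
    rw [Finset.mem_powersetCard_univ, Finset.card_image_of_injective _ hr, Finset.card_univ,
      Fintype.card_fin]

theorem append_update {α : Type*} {l N : ℕ} [DecidableEq (Fin l)] (v : Fin l → α) (c : Fin N → α)
    (i : Fin l) (w : α) : Fin.append (Function.update v i w) c =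
      Function.update (Fin.append v c) (Fin.castAdd N i) w := by
  ext j : 1
  induction j using Fin.addCases with
  | left j => by_cases h : j = i <;> simp [h]
  | right j =>
    rw [Fin.append_right, Function.update_of_ne, Fin.append_right]
    have := i.2
    rw [Ne, Fin.ext_iff, Fin.val_natAdd, Fin.val_castAdd]
    omega

/-- The determinant as an alternating map in its first `l` rows. -/
def detAppend {l N : ℕ} (c : Fin N → Fin (l + N) → R) :
    (Fin (l + N) → R) [⋀^Fin l]→ₗ[R] R where
  toFun v := Matrix.detRowAlternating (Fin.append v c)
  map_update_add' v i x z := by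
    simp only [append_update]
    exact AlternatingMap.map_update_add _ _ _ _ _
  map_update_smul' v i r x := by
    simp only [append_update]
    exact AlternatingMap.map_update_smul _ _ _ _ _
  map_eq_zero_of_eq' v i j hij hne := by
    refine AlternatingMap.map_eq_zero_of_eq _ _ (i := Fin.castAdd N i) (j := Fin.castAdd N j) ?_ ?_
    · rw [Fin.append_left, Fin.append_left, hij]
    · exact fun h => hne (Fin.castAdd_injective _ _ h)

theorem detAppend_apply {l N : ℕ} (c : Fin N → Fin (l + N) → R) (v : Fin l → Fin (l + N) → R) :
    detAppend c v = Matrix.det (Matrix.of (Fin.append v c)) :=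
  rfl

theorem sum_fin_ite_le {N : ℕ} (g c : ℕ → R) {j : ℕ} (hj : j < N) :
    ∑ i : Fin N, g i * (if (i : ℕ) ≤ j then c (j - i) else 0) =
      ∑ k ∈ Finset.range (j + 1), g (j - k) * c k := by
  rw [Fin.sum_univ_eq_sum_range (fun i => g i * (if i ≤ j then c (j - i) else 0)) N,
    ← Finset.sum_subset (Finset.range_subset_range.2 (Nat.succ_le_of_lt hj)),
    ← Finset.sum_range_reflect]
  · refine Finset.sum_congr rfl fun k hk => ?_
    have := Finset.mem_range.1 hk
    rw [if_pos (by omega), Nat.succ_eq_add_one, Nat.add_sub_cancel, Nat.sub_sub_self (by omega)]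
  · intro i _ hi
    rw [if_neg (by simpa using hi), mul_zero]

/-- Column `j ≥ l` is replaced by `∑ P_k · (column j - k)`, a unitriangular operation. In the upper
rows the new entry is `v_i^(j - l)` times the sum in `hv`, hence `0`; in the lower rows the shift by
`k` multiplies `H` by `P`. The matrix becomes block lower triangular. -/
theorem det_append_pow {l N : ℕ} (v : Fin l → R) (H : PowerSeries R) (a : Fin N → ℕ)
    (P : Polynomial R) (hP : P.natDegree ≤ l) (hP0 : P.coeff 0 = 1)
    (hv : ∀ i, ∑ k ∈ Finset.range (l + 1), v i ^ (l - k) * P.coeff k = 0) :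
    Matrix.det (Matrix.of (Fin.append (fun i (j : Fin (l + N)) => v i ^ (j : ℕ))
      fun i (j : Fin (l + N)) =>
        PowerSeries.coeff (a i) (PowerSeries.X ^ (l + N - 1 - (j : ℕ)) * H))) =
      Matrix.det (Matrix.of fun i j : Fin l => v i ^ (j : ℕ)) *
        jacobiTrudi (H * (P : PowerSeries R)) a := by
  let U : Matrix (Fin (l + N)) (Fin (l + N)) R := Matrix.of fun i j =>
    if (j : ℕ) < l then (if i = j then 1 else 0)
    else (if (i : ℕ) ≤ j then P.coeff (j - i) else 0)
  have hU : U.det = 1 := by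
    rw [Matrix.det_of_isUpperTriangular]
    · exact Finset.prod_eq_one fun i _ => by simp [U, hP0]
    · intro i j hij
      have : (j : ℕ) < i := hij
      simp only [U, Matrix.of_apply]
      rw [if_neg (show ¬ i = j by rintro rfl; omega), if_neg (show ¬ (i : ℕ) ≤ j by omega), ite_self]
  have hvz : ∀ (i : Fin l) (j : ℕ), l ≤ j →
      ∑ k ∈ Finset.range (j + 1), v i ^ (j - k) * P.coeff k = 0 := by
    intro i j hj
    rw [← Finset.sum_subset (Finset.range_subset_range.2 (Nat.succ_le_succ hj))]
    · rw [← mul_zero (v i ^ (j - l)), ← hv i, Finset.mul_sum]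
      refine Finset.sum_congr rfl fun k hk => ?_
      have := Finset.mem_range.1 hk
      rw [← mul_assoc, ← pow_add]
      congr 2
      omega
    · intro k _ hk
      rw [Polynomial.coeff_eq_zero_of_natDegree_lt, mul_zero]
      have : ¬ k < l + 1 := by simpa using hk
      omega
  have hrow : ∀ (e : ℕ) (j : ℕ), l ≤ j → j < l + N →
      ∑ k ∈ Finset.range (j + 1),
        PowerSeries.coeff e (PowerSeries.X ^ (l + N - 1 - (j - k)) * H) * P.coeff k =
      PowerSeries.coeff e (PowerSeries.X ^ (l + N - 1 - j) * (H * (P : PowerSeries R))) := by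
    intro e j hj hj'
    rw [coe_eq_sum_range (show P.natDegree < j + 1 by omega), Finset.mul_sum, Finset.mul_sum,
      map_sum]
    refine Finset.sum_congr rfl fun k hk => ?_
    have := Finset.mem_range.1 hk
    have e1 : l + N - 1 - (j - k) = (l + N - 1 - j) + k := by omega
    rw [e1, pow_add, mul_comm _ (P.coeff k), ← PowerSeries.coeff_C_mul]
    congr 1
    ring
  rw [← mul_one (Matrix.det (Matrix.of (Fin.append _ _))), ← hU, ← Matrix.det_mul, jacobiTrudi,
    ← Matrix.det_submatrix_equiv_self finSumFinEquiv]
  let D : Matrix (Fin N) (Fin N) R := Matrix.of fun i j : Fin N =>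
    PowerSeries.coeff (a i) (PowerSeries.X ^ (N - 1 - (j : ℕ)) * (H * (P : PowerSeries R)))
  let C : Matrix (Fin N) (Fin l) R := Matrix.of fun i j =>
    PowerSeries.coeff (a i) (PowerSeries.X ^ (l + N - 1 - (j : ℕ)) * H)
  rw [← Matrix.det_fromBlocks_zero₁₂ (Matrix.of fun i j : Fin l => v i ^ (j : ℕ)) C D]
  congr 1
  ext i j
  rw [Matrix.submatrix_apply, Matrix.mul_apply]
  rcases i with i | i <;> rcases j with j | j
  · simp [U]
  · simp only [U, finSumFinEquiv_apply_left, finSumFinEquiv_apply_right, Matrix.of_apply,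
      Fin.append_left, Fin.val_natAdd, Matrix.fromBlocks_apply₁₂, Matrix.zero_apply]
    simp only [if_neg (show ¬ l + (j : ℕ) < l by omega)]
    rw [sum_fin_ite_le (fun k => v i ^ k) P.coeff (by omega), hvz i _ (by omega)]
  · simp [U, C]
  · simp only [U, D, finSumFinEquiv_apply_right, Matrix.of_apply,
      Fin.append_right, Fin.val_natAdd, Matrix.fromBlocks_apply₂₂]
    simp only [if_neg (show ¬ l + (j : ℕ) < l by omega)]
    rw [sum_fin_ite_le (fun k => PowerSeries.coeff (a i) (PowerSeries.X ^ (l + N - 1 - k) * H))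
      P.coeff (by omega), hrow _ _ (by omega) (by omega)]
    congr 3
    omega

end Laplace


/-! ### Partial fractions and the Laplace expansion. -/

section PartialFractions

variable {F : Type*} [Field F]

theorem natDegree_prod_one_sub_le {ι : Type*} (s : Finset ι) (z : ι → F) :
    (∏ q ∈ s, (1 - Polynomial.C (z q) * Polynomial.X)).natDegree ≤ s.card := by
  refine (Polynomial.natDegree_prod_le _ _).trans
    ((Finset.sum_le_card_nsmul _ _ 1 fun q _ => ?_).trans (by simp))
  exact (Polynomial.natDegree_sub_le _ _).trans (by
    simpa using (Polynomial.natDegree_C_mul_le (z q) Polynomial.X).trans Polynomial.natDegree_X_le)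

theorem reflect_prod_X_sub_C {ι : Type*} (s : Finset ι) (z : ι → F) :
    Polynomial.reflect s.card (∏ q ∈ s, (Polynomial.X - Polynomial.C (z q))) =
      ∏ q ∈ s, (1 - Polynomial.C (z q) * Polynomial.X) := by
  classical
  induction s using Finset.induction_on with
  | empty => simp
  | insert q s hq ih =>
    rw [Finset.prod_insert hq, Finset.prod_insert hq, Finset.card_insert_of_notMem hq, add_comm,
      Polynomial.reflect_mul _ _ (F := 1) (G := s.card) (Polynomial.natDegree_X_sub_C_le _), ih]
    · congr 1
      rw [Polynomial.reflect_sub, Polynomial.reflect_C]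
      simp
    · simp

/-- The Lagrange basis polynomials at the nodes `z_p` sum to `1`; reversing coefficients in degree
`n - 1` turns `X - z_q` into `1 - z_q X` and `1` into `X ^ (n - 1)`. -/
theorem sum_inv_mul_prod_one_sub {n : ℕ} (hn : 0 < n) {z : Fin n → F}
    (hz : Function.Injective z) :
    ∑ p, Polynomial.C (∏ q ∈ Finset.univ.erase p, (z p - z q))⁻¹ *
      ∏ q ∈ Finset.univ.erase p, (1 - Polynomial.C (z q) * Polynomial.X) =
        Polynomial.X ^ (n - 1) := by
  have : NeZero n := ⟨hn.ne'⟩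
  have h1 := Lagrange.sum_basis (s := Finset.univ) (v := z) hz.injOn Finset.univ_nonempty
  have h2 := congrArg (Polynomial.reflect (n - 1)) h1
  have h3 : ∀ f : Fin n → Polynomial F, Polynomial.reflect (n - 1) (∑ p, f p) =
      ∑ p, Polynomial.reflect (n - 1) (f p) := fun f =>
    map_sum (AddMonoidHom.mk' (Polynomial.reflect (n - 1)) fun f g =>
      Polynomial.reflect_add f g (n - 1)) f Finset.univ
  rw [h3, ← Polynomial.C_1, Polynomial.reflect_C, Polynomial.C_1, one_mul] at h2
  rw [← h2]
  refine Finset.sum_congr rfl fun p _ => ?_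
  have hc : (Finset.univ.erase p).card = n - 1 := by
    rw [Finset.card_erase_of_mem (Finset.mem_univ p), Finset.card_univ, Fintype.card_fin]
  rw [← reflect_prod_X_sub_C, hc, Lagrange.basis]
  simp only [Lagrange.basisDivisor]
  rw [Finset.prod_mul_distrib, ← map_prod, Finset.prod_inv_distrib, Polynomial.reflect_C_mul]

theorem sum_inv_mul_geomSeries {n : ℕ} (hn : 0 < n) {z : Fin n → F}
    (hz : Function.Injective z) :
    ∑ p, PowerSeries.C (∏ q ∈ Finset.univ.erase p, (z p - z q))⁻¹ * geomSeries (z p) =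
      PowerSeries.X ^ (n - 1) * completeSeries z := by
  have h1 := congrArg (Polynomial.coeToPowerSeries.ringHom (R := F))
    (sum_inv_mul_prod_one_sub hn hz)
  simp only [map_sum, map_mul, map_prod, map_sub, map_one, map_pow,
    Polynomial.coeToPowerSeries.ringHom_apply, Polynomial.coe_C, Polynomial.coe_X] at h1
  rw [← h1, Finset.sum_mul]
  refine Finset.sum_congr rfl fun p _ => ?_
  have h2 : (∏ q ∈ Finset.univ.erase p, geomSeries (z q)) *
      ∏ q ∈ Finset.univ.erase p, (1 - PowerSeries.C (z q) * PowerSeries.X) = 1 := by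
    rw [← Finset.prod_mul_distrib, Finset.prod_eq_one fun q _ => geomSeries_mul (z q)]
  rw [completeSeries, ← Finset.mul_prod_erase _ _ (Finset.mem_univ p)]
  linear_combination (-PowerSeries.C (∏ q ∈ Finset.univ.erase p, (z p - z q))⁻¹ *
    geomSeries (z p)) * h2

/-- The coefficient of `1 / (1 - z_p t)` in the partial fraction decomposition of
`t^a ∏ (1 + y_j t) / ∏ (1 - z_q t)`. -/
noncomputable def weight {n m : ℕ} (z : Fin n → F) (y : Fin m → F) (p : Fin n) : F :=
  (∏ q ∈ Finset.univ.erase p, (z p - z q))⁻¹ * ∏ j, (z p + y j)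

theorem elementarySeries_succ {m : ℕ} (y : Fin (m + 1) → F) :
    elementarySeries y = elementarySeries (fun j : Fin m => y j.castSucc) *
      (1 + PowerSeries.C (y (Fin.last m)) * PowerSeries.X) := by
  rw [elementarySeries, Fin.prod_univ_castSucc]; rfl

/-- Induction on `m`: a further factor `1 + y t` combines the sums with `z_p^(d+1)` and `y z_p^d`,
and so multiplies the weight by `z_p + y`. That `d` is a natural number is the condition `A + n > B
+ m`, under which the polynomial part of the partial fraction decomposition does not contribute. -/
theorem coeff_completeSeries_mul_elementarySeries {n m : ℕ} (hn : 0 < n) {z : Fin n → F}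
    (hz : Function.Injective z) (y : Fin m → F) {A B d : ℕ} (h : A + n = B + m + d + 1) :
    PowerSeries.coeff A (PowerSeries.X ^ B * (completeSeries z * elementarySeries y)) =
      ∑ p, weight z y p * z p ^ d := by
  induction m generalizing B d with
  | zero =>
    have h1 := congrArg (PowerSeries.coeff d) (sum_inv_mul_geomSeries hn hz)
    simp only [map_sum, PowerSeries.coeff_C_mul, geomSeries, PowerSeries.coeff_mk] at h1
    simp only [weight, Finset.univ_eq_empty, Finset.prod_empty, mul_one, elementarySeries]
    rw [h1, PowerSeries.coeff_X_pow_mul', PowerSeries.coeff_X_pow_mul']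
    by_cases hB : B ≤ A
    · rw [if_pos hB, if_pos (by omega)]
      congr 1
      have e : A - B = d - (n - 1) := by omega
      rw [e]
    · rw [if_neg hB, if_neg (by omega)]
  | succ m ih =>
    have e1 : PowerSeries.X ^ B * (completeSeries z * elementarySeries y) =
        PowerSeries.X ^ B *
          (completeSeries z * elementarySeries fun j : Fin m => y j.castSucc) +
        PowerSeries.C (y (Fin.last m)) * (PowerSeries.X ^ (B + 1) *
          (completeSeries z * elementarySeries fun j : Fin m => y j.castSucc)) := by
      rw [elementarySeries_succ]; ring
    rw [e1, map_add, PowerSeries.coeff_C_mul, ih (fun j => y j.castSucc) (B := B) (d := d + 1)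
      (by omega), ih (fun j => y j.castSucc) (B := B + 1) (d := d) (by omega), Finset.mul_sum,
      ← Finset.sum_add_distrib]
    refine Finset.sum_congr rfl fun p _ => ?_
    rw [weight, weight, Fin.prod_univ_castSucc]
    ring

/-- With as many rows as variables, partial fractions factor the matrix as `(z_p^(b_i - m))` times
the diagonal matrix of weights times a Vandermonde matrix. -/
theorem jacobiTrudi_eq_det_mul_det {l m : ℕ} {z : Fin l → F} (hz : Function.Injective z)
    (y : Fin m → F) {b : Fin l → ℕ} (hb : ∀ i, m ≤ b i) :
    jacobiTrudi (completeSeries z * elementarySeries y) b =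
      (∏ p, weight z y p) * Matrix.det (Matrix.of fun i p : Fin l => z p ^ (b i - m)) *
        Matrix.det (Matrix.of fun i j : Fin l => z i ^ (j : ℕ)) := by
  rw [← Matrix.det_mul_row, ← Matrix.det_mul, jacobiTrudi]
  congr 1
  ext i j
  have := hb i
  rw [Matrix.of_apply, Matrix.mul_apply, coeff_completeSeries_mul_elementarySeries i.pos hz y
    (d := b i - m + j) (by omega)]
  refine Finset.sum_congr rfl fun p _ => ?_
  rw [Matrix.of_apply, Matrix.of_apply, Matrix.of_apply, mul_assoc, ← pow_add]

theorem prod_orderEmbOfFin {M : Type*} [CommMonoid M] {n l : ℕ} {K : Finset (Fin n)}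
    (h : K.card = l) (f : Fin n → M) : ∏ i, f (K.orderEmbOfFin h i) = ∏ p ∈ K, f p := by
  conv_rhs => rw [← Finset.map_orderEmbOfFin_univ K h, Finset.prod_map]
  rfl

theorem completeSeries_orderEmbOfFin {n l : ℕ} {K : Finset (Fin n)} (h : K.card = l)
    (z : Fin n → F) :
    completeSeries (fun i => z (K.orderEmbOfFin h i)) = ∏ p ∈ K, geomSeries (z p) :=
  prod_orderEmbOfFin h fun p => geomSeries (z p)

/-- In the weight of `p ∈ K`, the factors with `q ∈ K` give the weight relative to the variables of
`K` alone; those with `q ∉ K` give the cross product. -/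
theorem prod_weight {n l m : ℕ} {K : Finset (Fin n)} (h : K.card = l) (z : Fin n → F)
    (y : Fin m → F) :
    ∏ i, weight z y (K.orderEmbOfFin h i) =
      (∏ i, weight (fun i => z (K.orderEmbOfFin h i)) y i) *
        (∏ s ∈ K, ∏ t ∈ Kᶜ, (z s - z t))⁻¹ := by
  rw [← prod_orderEmbOfFin h fun s => ∏ t ∈ Kᶜ, (z s - z t), ← Finset.prod_inv_distrib,
    ← Finset.prod_mul_distrib]
  refine Finset.prod_congr rfl fun i _ => ?_
  have h1 : Finset.univ.erase (K.orderEmbOfFin h i) =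
      (Finset.univ.erase i).map (K.orderEmbOfFin h).toEmbedding ∪ Kᶜ := by
    have h2 : (Finset.univ.erase i).map (K.orderEmbOfFin h).toEmbedding =
        K.erase (K.orderEmbOfFin h i) := by
      rw [Finset.map_erase, Finset.map_orderEmbOfFin_univ]; rfl
    rw [h2]
    ext p
    have := K.orderEmbOfFin_mem h i
    by_cases hp : p = K.orderEmbOfFin h i
    · subst hp; simp
    · simp [hp, em]
  rw [weight, weight, h1, Finset.prod_union, Finset.prod_map, mul_inv]
  · simp only [RelEmbedding.coe_toEmbedding]
    ring
  · rw [Finset.disjoint_left]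
    intro p hp
    obtain ⟨j, -, rfl⟩ := Finset.mem_map.1 hp
    simp

theorem completeSeries_mul_prod {n : ℕ} (K : Finset (Fin n)) (z : Fin n → F) :
    completeSeries z * ((∏ q ∈ K, (1 - Polynomial.C (z q) * Polynomial.X) : Polynomial F) :
      PowerSeries F) = ∏ p ∈ Kᶜ, geomSeries (z p) := by
  have h1 : ((∏ q ∈ K, (1 - Polynomial.C (z q) * Polynomial.X) : Polynomial F) :
      PowerSeries F) = ∏ q ∈ K, (1 - PowerSeries.C (z q) * PowerSeries.X) := by
    rw [← Polynomial.coeToPowerSeries.ringHom_apply, map_prod]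
    simp
  rw [h1, completeSeries, ← Finset.prod_mul_prod_compl K, mul_right_comm,
    ← Finset.prod_mul_distrib, Finset.prod_eq_one fun p _ => geomSeries_mul _, one_mul]

/-- After reversal, the sum is the value of `∏ (X - z_q)` at its root `z_p`. -/
theorem sum_pow_mul_coeff_prod {n : ℕ} {K : Finset (Fin n)} (z : Fin n → F) {p : Fin n}
    (hp : p ∈ K) :
    ∑ k ∈ Finset.range (K.card + 1), z p ^ (K.card - k) *
      (∏ q ∈ K, (1 - Polynomial.C (z q) * Polynomial.X)).coeff k = 0 := by
  rw [← reflect_prod_X_sub_C]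
  have h1 : (∏ q ∈ K, (Polynomial.X - Polynomial.C (z q))).eval (z p) = 0 := by
    rw [Polynomial.eval_prod]
    exact Finset.prod_eq_zero hp (by simp)
  rw [Polynomial.eval_eq_sum_range' (n := K.card + 1)] at h1
  · rw [← h1, ← Finset.sum_range_reflect]
    refine Finset.sum_congr rfl fun k hk => ?_
    have := Finset.mem_range.1 hk
    rw [Polynomial.coeff_reflect, Polynomial.revAt_le (by omega), mul_comm]
    congr 2 <;> omega
  · refine Nat.lt_succ_of_le ?_
    simp

/-- Laplace expansion of a Jacobi-Trudi determinant along its first `l` rows. -/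
theorem jacobiTrudi_append {n m l N c : ℕ} (hln : l ≤ n) (hc : c + n = l + N) {z : Fin n → F}
    (hz : Function.Injective z) (y : Fin m → F) {b : Fin l → ℕ} (hb : ∀ i, m ≤ b i)
    (a : Fin N → ℕ) :
    jacobiTrudi (completeSeries z * elementarySeries y) (Fin.append (fun i => b i + c) a) =
      ∑ K ∈ Finset.powersetCard l Finset.univ,
        jacobiTrudi ((∏ p ∈ K, geomSeries (z p)) * elementarySeries y) b *
          jacobiTrudi ((∏ p ∈ Kᶜ, geomSeries (z p)) * elementarySeries y) a *
            (∏ s ∈ K, ∏ t ∈ Kᶜ, (z s - z t))⁻¹ := by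
  let C : Fin N → Fin (l + N) → F := fun i j => PowerSeries.coeff (a i)
    (PowerSeries.X ^ (l + N - 1 - (j : ℕ)) * (completeSeries z * elementarySeries y))
  -- By `hc` the exponent of partial fractions at row `i`, column `j` is `d = b i - m + j`, so the
  -- first `l` rows are combinations of the rows `(z_p^j)_j`.
  have h1 : jacobiTrudi (completeSeries z * elementarySeries y)
      (Fin.append (fun i => b i + c) a) =
      detAppend C fun i => ∑ p, (weight z y p * z p ^ (b i - m)) •
        fun j : Fin (l + N) => z p ^ (j : ℕ) := by
    rw [detAppend_apply, jacobiTrudi]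
    congr 1
    ext i j
    rw [Matrix.of_apply, Matrix.of_apply]
    induction i using Fin.addCases with
    | left i =>
      have := hb i
      have := i.pos
      rw [Fin.append_left, Fin.append_left, coeff_completeSeries_mul_elementarySeries (by omega)
        hz y (d := b i - m + j) (by omega), Finset.sum_apply]
      refine Finset.sum_congr rfl fun p _ => ?_
      rw [Pi.smul_apply, smul_eq_mul, pow_add, mul_assoc]
    | right i => rw [Fin.append_right, Fin.append_right]
  rw [h1]
  refine alternatingMap_sum_smul (detAppend C)
    (fun i p => weight z y p * z p ^ (b i - m)) _ _ fun K h => ?_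
  have h2 := det_append_pow (fun i => z (K.orderEmbOfFin h i))
    (completeSeries z * elementarySeries y) a
    (∏ q ∈ K, (1 - Polynomial.C (z q) * Polynomial.X))
    ((natDegree_prod_one_sub_le K z).trans h.le)
    (by simp [Polynomial.coeff_zero_prod]) (fun i => by
      have := sum_pow_mul_coeff_prod z (K.orderEmbOfFin_mem h i)
      rwa [h] at this)
  have h3 := Matrix.det_mul_row (fun j => weight z y (K.orderEmbOfFin h j))
    (Matrix.of fun i j : Fin l => z (K.orderEmbOfFin h j) ^ (b i - m))
  simp only [Matrix.of_apply] at h3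
  -- The minor of coefficients from Cauchy-Binet and the Vandermonde determinant from `h2`
  -- recombine, by `jacobiTrudi_eq_det_mul_det`, into the Jacobi-Trudi determinant for the variables
  -- of `K`.
  rw [detAppend_apply, h2, mul_right_comm, mul_right_comm (completeSeries z),
    completeSeries_mul_prod, h3,
    prod_weight h, ← completeSeries_orderEmbOfFin h,
    jacobiTrudi_eq_det_mul_det (z := fun i => z (K.orderEmbOfFin h i))
      (hz.comp (K.orderEmbOfFin h).injective) y hb, smul_eq_mul]
  ring

end PartialFractions


/-! ### Parts of the constructed partitions, indices, and sorting of the overlap. -/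

section Overlap

theorem rowLen_ofRowLens_eq_getD (w : List ℕ) (hw : w.SortedGE) (j : ℕ) :
    (YoungDiagram.ofRowLens w hw).rowLen j = w.getD j 0 := by
  by_cases hj : j < w.length
  · rw [List.getD_eq_getElem _ _ hj]
    exact YoungDiagram.rowLen_ofRowLens (hw := hw) ⟨j, hj⟩
  · rw [List.getD_eq_default _ _ (not_lt.1 hj)]
    by_contra h
    obtain ⟨h1, -⟩ := YoungDiagram.mem_ofRowLens.1
      (YoungDiagram.mem_iff_lt_rowLen.2 (Nat.pos_of_ne_zero h) :
        (j, 0) ∈ YoungDiagram.ofRowLens w hw)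
    exact hj h1

theorem getD_rowLens (la : YoungDiagram) (j : ℕ) : la.rowLens.getD j 0 = la.rowLen j := by
  by_cases hj : j < la.colLen 0
  · have h : j < la.rowLens.length := by rwa [YoungDiagram.length_rowLens]
    rw [List.getD_eq_getElem _ _ h, YoungDiagram.get_rowLens]
  · rw [List.getD_eq_default _ _ (by rw [YoungDiagram.length_rowLens]; omega),
      rowLen_eq_zero (not_lt.1 hj)]

theorem rowLen_addRect {mu : YoungDiagram} {k : ℤ} {l j : ℕ} (hj : j < l) :
    (addRect mu k l).rowLen j = ((mu.rowLen j : ℤ) + k).toNat := by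
  rw [addRect, rowLen_ofRowLens_eq_getD, List.getD_eq_getElem _ _ (by simpa using hj)]
  simp

theorem colLen_addRect_le (mu : YoungDiagram) (k : ℤ) (l : ℕ) : (addRect mu k l).colLen 0 ≤ l := by
  rw [← rowLen_le_iff, addRect, rowLen_ofRowLens_eq_getD, List.getD_eq_default _ _ (by simp)]

theorem rowLen_initialParts {nu : YoungDiagram} {r j : ℕ} (hj : j < r) :
    (initialParts nu r).rowLen j = nu.rowLen j := by
  rw [initialParts, rowLen_ofRowLens_eq_getD, ← getD_rowLens nu, List.getD_eq_getElem?_getD,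
    List.getD_eq_getElem?_getD, List.getElem?_take_of_lt hj]

theorem rowLen_remainingParts (nu : YoungDiagram) (r j : ℕ) :
    (remainingParts nu r).rowLen j = nu.rowLen (r + j) := by
  rw [remainingParts, rowLen_ofRowLens_eq_getD, ← getD_rowLens nu, List.getD_eq_getElem?_getD,
    List.getD_eq_getElem?_getD, List.getElem?_drop]

theorem mem_rowLens {la : YoungDiagram} {a : ℕ} :
    a ∈ la.rowLens ↔ ∃ i < la.colLen 0, la.rowLen i = a := by
  simp [YoungDiagram.rowLens]

theorem rowLen_union {la mu : YoungDiagram} {t : ℕ} (hl : la.colLen 0 ≤ t)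
    (h : ∀ i < t, mu.rowLen 0 ≤ la.rowLen i) (j : ℕ) :
    (union la mu).rowLen j = if j < t then la.rowLen j else mu.rowLen (j - t) := by
  have hs : (la.rowLens ++ mu.rowLens).Pairwise (· ≥ ·) := by
    refine List.pairwise_append.2 ⟨List.sortedGE_iff_pairwise.1 la.rowLens_sorted,
      List.sortedGE_iff_pairwise.1 mu.rowLens_sorted, fun a ha b hb => ?_⟩
    obtain ⟨i, hi, rfl⟩ := mem_rowLens.1 ha
    obtain ⟨i', -, rfl⟩ := mem_rowLens.1 hb
    exact (mu.rowLen_anti 0 i' (Nat.zero_le _)).trans (h i (hi.trans_le hl))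
  have h1 : (union la mu).rowLen j = (la.rowLens ++ mu.rowLens).getD j 0 := by
    rw [union, rowLen_ofRowLens_eq_getD, List.Pairwise.insertionSort_eq hs]
  rw [h1]
  by_cases hj : j < la.colLen 0
  · rw [List.getD_append _ _ _ _ (by rwa [YoungDiagram.length_rowLens]), getD_rowLens,
      if_pos (hj.trans_le hl)]
  · rw [List.getD_append_right _ _ _ _ (by rw [YoungDiagram.length_rowLens]; omega),
      getD_rowLens, YoungDiagram.length_rowLens]
    -- If `t` exceeds the true length of `la`, then `la` has a zero part before position `t`, and
    -- `h` forces `mu` to be empty.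
    rcases hl.lt_or_eq with hlt | heq
    · have h2 := h _ hlt
      rw [rowLen_eq_zero le_rfl] at h2
      have h3 : ∀ i, mu.rowLen i = 0 := fun i =>
        Nat.le_zero.1 ((mu.rowLen_anti 0 i (Nat.zero_le _)).trans h2)
      rw [h3, h3, rowLen_eq_zero (not_lt.1 hj), ite_self]
    · rw [heq, if_neg (by omega)]

theorem IsOverlap.overlap_eq {m n : ℕ} {mu nu la : YoungDiagram} {s : Equiv.Perm (Fin (m + n))}
    (h : IsOverlap m n mu nu la s) : overlap m n mu nu = (la : WithTop YoungDiagram) := by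
  have h1 : ∃ la s, IsOverlap m n mu nu la s := ⟨la, s, h⟩
  obtain ⟨s', h2⟩ := Classical.choose_spec h1
  rw [overlap, dif_pos h1, (h2.unique h).1]

theorem IsOverlap.overlapSign_eq {m n : ℕ} {mu nu la : YoungDiagram}
    {s : Equiv.Perm (Fin (m + n))} (h : IsOverlap m n mu nu la s) :
    overlapSign m n mu nu = (Equiv.Perm.sign s : ℤ) := by
  have h1 : ∃ s la, IsOverlap m n mu nu la s := ⟨s, la, h⟩
  obtain ⟨la', h2⟩ := Classical.choose_spec h1
  rw [overlapSign, dif_pos h1, (h2.unique h).2]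

theorem exists_isOverlap {m n : ℕ} {mu nu : YoungDiagram}
    (h : Function.Injective (overlapSeq m n mu nu)) : ∃ la s, IsOverlap m n mu nu la s := by
  obtain ⟨la, s, h1, h2⟩ := exists_perm_shifted h
  exact ⟨la, s, h1, fun i => congrFun h2 i⟩

theorem IsIndex.rowLen_le {nu : YoungDiagram} {m n r : ℕ} {k : ℤ} (h : IsIndex nu m n k)
    (hr : (r : ℤ) = n - k) : (nu.rowLen r : ℤ) ≤ m - k := by
  by_contra! h1
  have h2 := h.1.1
  refine h.1.2 ⟨by omega, by omega, ?_⟩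
  have e : ((n : ℤ) + 1 - k - 1).toNat = r := by omega
  rw [e]
  omega

/-- Were the last of the `l` parts smaller than `m`, the point `(m, l)` would lie outside the
diagram and the index would be at least `1`. -/
theorem IsIndex.le_rowLen {la : YoungDiagram} {m l j : ℕ} (h : IsIndex la m l 0) (hj : j < l) :
    m ≤ la.rowLen j := by
  by_contra! h1
  have h2 := la.rowLen_anti j (l - 1) (by omega)
  have h3 : (1 : ℤ) ≤ 0 := h.2 ⟨by omega, fun ⟨_, _, h4⟩ => by
    have e : ((l : ℤ) + 1 - 1 - 1).toNat = l - 1 := by omega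
    rw [e] at h4
    omega⟩
  omega

variable {l r : ℕ} (q : ℕ) (mu nu : YoungDiagram)

/-- The positions of a sequence of length `l + (r + q)`, split into the first `l + r` and the last
`q`. -/
def splitEquiv (l r q : ℕ) : Fin (l + r) ⊕ Fin q ≃ Fin (l + (r + q)) :=
  finSumFinEquiv.trans (finCongr (Nat.add_assoc l r q))

theorem append_splitEquiv_inl (i : Fin (l + r)) :
    Fin.append (fun i => shifted l mu i + q) (shifted (r + q) nu) (splitEquiv l r q (Sum.inl i)) =
      overlapSeq l r mu (initialParts nu r) i + q := by
  induction i using Fin.addCases with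
  | left i =>
    have e : splitEquiv l r q (Sum.inl (Fin.castAdd r i)) = Fin.castAdd (r + q) i := rfl
    rw [e, Fin.append_left, overlapSeq, Fin.append_left]
  | right i =>
    have e : splitEquiv l r q (Sum.inl (Fin.natAdd l i)) = Fin.natAdd l (Fin.castAdd q i) := rfl
    rw [e, Fin.append_right, overlapSeq, Fin.append_right]
    simp only [shifted, Fin.val_castAdd, rowLen_initialParts i.2]
    omega

theorem append_splitEquiv_inr (i : Fin q) :
    Fin.append (fun i => shifted l mu i + q) (shifted (r + q) nu) (splitEquiv l r q (Sum.inr i)) =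
      nu.rowLen (r + i) + (q - 1 - i) := by
  have e : splitEquiv l r q (Sum.inr i) = Fin.natAdd l (Fin.natAdd r i) := by
    ext; simp [splitEquiv]; omega
  rw [e, Fin.append_right]
  simp only [shifted, Fin.val_natAdd]
  omega

/-- By `hle`, appending the tail of `nu` to the overlap yields a partition. Hence the sorting
permutation is `s` on the first `l + r` positions and the identity on the last `q`, and its sign is
that of `s`. -/
theorem shifted_union {la : YoungDiagram} {s : Equiv.Perm (Fin (l + r))}
    (h : IsOverlap l r mu (initialParts nu r) la s)
    (hle : ∀ i < l + r, nu.rowLen r ≤ la.rowLen i) :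
    shifted (l + (r + q)) (union la (remainingParts nu r)) =
      Fin.append (fun i => shifted l mu i + q) (shifted (r + q) nu) ∘
        (splitEquiv l r q).permCongr (Equiv.sumCongr s (Equiv.refl _)) := by
  have hrow := rowLen_union (mu := remainingParts nu r) h.1
    (by simpa [rowLen_remainingParts] using hle)
  ext i
  obtain ⟨i, rfl⟩ := (splitEquiv l r q).surjective i
  rw [Function.comp_apply, Equiv.permCongr_apply, Equiv.symm_apply_apply]
  rcases i with i | i
  · rw [Equiv.sumCongr_apply, Sum.map_inl, append_splitEquiv_inl, ← h.2]
    have e : ((splitEquiv l r q (Sum.inl i) : Fin (l + (r + q))) : ℕ) = i := by simp [splitEquiv]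
    rw [shifted, shifted, e, hrow, if_pos i.2]
    omega
  · rw [Equiv.sumCongr_apply, Sum.map_inr, append_splitEquiv_inr]
    have e : ((splitEquiv l r q (Sum.inr i) : Fin (l + (r + q))) : ℕ) = l + r + i := by
      simp [splitEquiv]
    rw [shifted, e, hrow, if_neg (by omega), rowLen_remainingParts, Nat.add_sub_cancel_left,
      Equiv.refl_apply]
    omega

/-- At the last position `ρ` vanishes, so the smallest part of `la` is itself an entry of the
overlap sequence, and all these entries are at least `nu.rowLen r`. -/
theorem IsOverlap.rowLen_le {mu nu la : YoungDiagram} {s : Equiv.Perm (Fin (l + r))}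
    (h : IsOverlap l r mu (initialParts nu r) la s) (hmu : ∀ j < l, nu.rowLen r ≤ mu.rowLen j)
    {i : ℕ} (hi : i < l + r) : nu.rowLen r ≤ la.rowLen i := by
  have h1 := h.2 ⟨l + r - 1, by omega⟩
  have h2 : ∀ j, nu.rowLen r ≤ overlapSeq l r mu (initialParts nu r) j := by
    intro j
    rw [overlapSeq]
    induction j using Fin.addCases with
    | left j =>
      rw [Fin.append_left]
      exact (hmu j j.2).trans (Nat.le_add_right _ _)
    | right j =>
      rw [Fin.append_right, shifted, rowLen_initialParts j.2]
      exact (nu.rowLen_anti j r j.2.le).trans (Nat.le_add_right _ _)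
  have h3 := h2 (s ⟨l + r - 1, by omega⟩)
  rw [← h1, shifted] at h3
  have h4 := la.rowLen_anti i (l + r - 1) (by omega)
  simp only at h3
  omega

end Overlap

/-! ### Complementary subsequences and the cross product of differences. -/

section Subsequences

variable {F : Type*} [Field F] {n : ℕ}

theorem completeSeries_neg_subseq (x : Fin n → F) (K : Finset (Fin n)) :
    completeSeries (-subseq x K) = ∏ p ∈ K, geomSeries (-x p) :=
  completeSeries_orderEmbOfFin rfl fun p => -x p

/-- No sign appears because `t - s = (-s) - (-t)`: exchanging the two sequences compensates the
negation of the variables. -/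
theorem crossDelta_subseq (x : Fin n → F) (K : Finset (Fin n)) :
    crossDelta (subseq x Kᶜ) (subseq x K) = ∏ s ∈ K, ∏ t ∈ Kᶜ, (-x s - -x t) := by
  rw [crossDelta, Finset.prod_comm, ← prod_orderEmbOfFin (K := K) rfl]
  refine Finset.prod_congr rfl fun i _ => ?_
  rw [← prod_orderEmbOfFin (K := Kᶜ) rfl]
  exact Finset.prod_congr rfl fun j _ => by simp only [subseq]; ring

end Subsequences

end LittlewoodSchur

/-! ### The overlap identity. -/

open LittlewoodSchur
theorem mainTheorem3 {F : Type*} [Field F] {n m : ℕ} (mu nu : YoungDiagram)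
    (x : Fin n → F) (hx : Function.Injective x) (y : Fin m → F)
    (l : ℕ) (hmu : mu.colLen 0 ≤ l) (hln : l ≤ n)
    (k : ℤ) (hk : IsIndex nu m (n - l) k) (hlk : (l : ℤ) ≤ n - k)
    (hpart : ∀ j < l, 0 ≤ (mu.rowLen j : ℤ) + k)
    (hindex : IsIndex (addRect mu k l) m l 0)
    (r : ℕ) (hr : (r : ℤ) = n - l - k) :
    littlewoodSchurTop
        ((overlap l r mu (initialParts nu r)).map fun la => union la (remainingParts nu r))
        (-x) y =
      ∑ K ∈ Finset.powersetCard l (Finset.univ : Finset (Fin n)),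
        (overlapSign l r mu (initialParts nu r) : F) *
          littlewoodSchur (addRect mu k l) (-subseq x K) y *
          littlewoodSchur nu (-subseq x Kᶜ) y /
          crossDelta (subseq x Kᶜ) (subseq x K) := by
  -- Padding by `q` rows makes `r + q` at least the length of `nu` and keeps the truncated
  -- difference `l + (r + q) - n` genuine.
  let q := n + nu.colLen 0
  let a : Fin (l + (r + q)) → ℕ := Fin.append (fun i => shifted l mu i + q) (shifted (r + q) nu)
  let H := completeSeries (-x) * elementarySeries y
  have hz : Function.Injective (-x) := neg_injective.comp hx
  have hb : ∀ i : Fin l, m ≤ shifted l (addRect mu k l) i := fun i =>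
    (hindex.le_rowLen i.2).trans (Nat.le_add_right _ _)
  -- Since `r = n - l - k`, the shift `l + (r + q) - n` equals `q - k`, which offsets the `k` added
  -- to the parts of `mu`.
  have hshift : (fun i => shifted l mu i + q) =
      fun i : Fin l => shifted l (addRect mu k l) i + (l + (r + q) - n) := by
    ext i
    have := hpart i i.2
    simp only [shifted, rowLen_addRect i.2]
    omega
  have hsum : ∑ K ∈ Finset.powersetCard l (Finset.univ : Finset (Fin n)),
      (overlapSign l r mu (initialParts nu r) : F) *
        littlewoodSchur (addRect mu k l) (-subseq x K) y *
        littlewoodSchur nu (-subseq x Kᶜ) y / crossDelta (subseq x Kᶜ) (subseq x K) =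
      (overlapSign l r mu (initialParts nu r) : F) * jacobiTrudi H a := by
    simp only [a, H]
    rw [hshift, jacobiTrudi_append hln (by omega) hz y hb, Finset.mul_sum]
    refine Finset.sum_congr rfl fun K _ => ?_
    rw [littlewoodSchur_eq_jacobiTrudi (colLen_addRect_le mu k l),
      littlewoodSchur_eq_jacobiTrudi (N := r + q) (by omega), completeSeries_neg_subseq,
      completeSeries_neg_subseq, crossDelta_subseq, div_eq_mul_inv]
    simp only [Pi.neg_apply, mul_assoc]
  rw [hsum]
  by_cases hex : ∃ la s, IsOverlap l r mu (initialParts nu r) la s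
  · obtain ⟨la, s, h⟩ := hex
    have hnu := hk.rowLen_le (r := r) (by omega)
    -- The two indices meet here: `nu_{r+1} ≤ m - k ≤ mu_j` for every `j ≤ l`.
    have hle : ∀ i < l + r, nu.rowLen r ≤ la.rowLen i := fun i hi =>
      h.rowLen_le (fun j hj => by
        have h1 := hindex.le_rowLen hj
        have := hpart j hj
        rw [rowLen_addRect hj] at h1
        omega) hi
    have hs := shifted_union q mu nu h hle
    have hlen : (union la (remainingParts nu r)).colLen 0 ≤ l + (r + q) := by
      rw [← rowLen_le_iff, rowLen_union (mu := remainingParts nu r) h.1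
        (by simpa [rowLen_remainingParts] using hle), if_neg (by omega), rowLen_remainingParts,
        rowLen_eq_zero (by omega)]
    rw [h.overlap_eq, h.overlapSign_eq]
    change littlewoodSchur (union la (remainingParts nu r)) (-x) y = _
    rw [littlewoodSchur_eq_jacobiTrudi hlen, hs, jacobiTrudi_comp_perm, Equiv.Perm.sign_permCongr,
      Equiv.Perm.sign_sumCongr, Equiv.Perm.sign_refl, mul_one]
  -- Without an overlap two of the first `l + r` exponents coincide, so the determinant has two
  -- equal rows.
  · have h1 : jacobiTrudi H a = 0 := by
      refine jacobiTrudi_eq_zero _ fun hinj => hex (exists_isOverlap fun i j hij => ?_)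
      have h2 : a (splitEquiv l r q (Sum.inl i)) = a (splitEquiv l r q (Sum.inl j)) := by
        simp only [a, append_splitEquiv_inl, hij]
      exact Sum.inl_injective ((splitEquiv l r q).injective (hinj h2))
    rw [h1, mul_zero, overlap, dif_neg hex]
    rfl
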